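/- **Conventions.** A length function on a group $G$ is a map $L:G\to\mathbb R_{\ge 0}$ with $L(gh)\le L(g)+L(h)$, $L(g^{-1})=L(g)$ and $L(1)=0$. All polynomials below have non-negative real coefficients. $(G,L)$ has *property RD* if there is a polynomial $P$ such that $\|\phi*\psi\|_2^2\le P(r)\,\|\phi\|_2^2\,\|\psi\|_2^2$ for all $r>0$ and all finitely supported $\phi,\psi:G\to\mathbb R_{\ge0}$ with $L\le r$ on the support of $\phi$, where $\phi*\psi(k)=\sum_{g}\phi(g)\psi(g^{-1}k)$. Let $H_1,\dots,H_m$ be subgroups of $G$, let $\mathrm{dist}(a,b)=L(a^{-1}b)$, and let $G$ act on itself by left multiplication. A map $rc:G^2\to\bigcup_i G\cdot H_i^3$, where $G\cdot H^3=\{(gh_1,gh_2,gh_3): g\in G,\ h_j\in H\}$, is a *relative centroid map* with respect to $H_1,\dots,H_m$ if for some polynomial $P$: * $(rc_1)$ for all $k\in G$, $r\ge0$, there are at most $P(r)$ pairs $(\alpha,\gamma)$ such that $rc(g,k)=(\alpha,\beta,\gamma)$ for some $g$ with $L(g)\le r$ and some $\beta$; * $(rc_2)$ for all $g\in G$ there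 are at most $P(L(g))$ pairs $(\alpha,\beta)$ such that $rc(g,k)=(\alpha,\beta,\gamma)$ for some $k,\gamma$; * $(rc_3)$ for all $h\in G$, $r\ge0$, there are at most $P(r)$ pairs of the form $(g^{-1}\beta,g^{-1}\gamma)$ with $L(g)\le r$ and $rc(g,gh)=(\alpha,\beta,\gamma)$ for some $\alpha$; * $(rc_4)$ if $rc(g,k)=(\alpha,\beta,\gamma)$, then $\mathrm{dist}(\alpha,\beta)\le P(L(g))$, $\mathrm{dist}(\alpha,\gamma)\le P(L(k))$ and $\mathrm{dist}(\beta,\gamma)\le P(L(g^{-1}k))$. $G$ has the *relative centroid property* with respect to $H_1,\dots,H_m$ if such a map exists. **Theorem.** Let $\Gamma$ be a finite simple graph with vertex set $V$. For every $v\in V$ let $G_v$ be a group with a length function $L_v$. Let $G=\prod_\Gamma G_v$ be the graph product, i.e. the quotient of the free product of the $G_v$ by the normal subgroup generated by the commutators $[a,b]$ with $a\in G_u$, $b\in G_v$, $u,v$ adjacent. For $g\in G$ let $\lambda(g)$ be the least $m$ for which $g=g_1\cdots g_m$ with $g_i\in G_{v_i}\setminus\{1\}$ and $v_i\ne v_{i+1}$;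 a representation with $m=\lambda(g)$ is called reduced. For a clique $C\subseteq V$ (possibly empty) let $G_C\le G$ be the subgroup generated by the $G_v$, $v\in C$. Then: 1. The formula $L(g)=\sum_{i=1}^m L_{v_i}(g_i)+\lambda(g)$, for any reduced representation $g=g_1\cdots g_m$, gives a well-defined length function on $G$, and $L(g)=0$ only for $g=1$. 2. $(G,L)$ has the relative centroid property with respect to the clique subgroups $G_C$, $C$ a clique of $\Gamma$. 3. Explicitly: for all $g,k\in G$ there are a clique $C$ and $g_1,w,h_1\in G$, $s_1,s_2\in G_C$ with $\lambda(s_1)=\lambda(s_2)=\lambda(s_1s_2)=|C|$, such that $g=g_1s_1w$, $g^{-1}k=w^{-1}s_2h_1$, $k=g_1(s_1s_2)h_1$, where $\lambda$ is additive in each of these three products (of the factors $g_1,s_1,w$; $w^{-1},s_2,h_1$; $g_1,s_1s_2,h_1$), and $\lambda(g)+\lambda(g^{-1}k)=\lambda(k)+|C|+2\lambda(w)$. Every map of the form $rc(g,k)=(g_1,g_1s_1,g_1s_1s_2)$, with such elements chosen for every pair $(g,k)$, is a relative centroid map with respect to the clique subgroups. 4. $(G,L)$ has property RD if and only if $(G_v,L_v)$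 has property RD for every $v\in V$. -/

import Mathlib

/-! ### Counting, polynomials, rapid decay -/

/-- The set `S` is finite and has at most `b` elements. -/
def CountLE {α : Type*} (S : Set α) (b : ℝ) : Prop :=
  S.Finite ∧ (S.ncard : ℝ) ≤ b

/-- All coefficients of the real polynomial `P` are non-negative. -/
def NonnegCoeffs (P : Polynomial ℝ) : Prop :=
  ∀ n, 0 ≤ P.coeff n

/-- The convolution `(φ * ψ)(k) = ∑ g, φ g * ψ (g⁻¹ k)` (used for finitely supported `φ`). -/
noncomputable def groupConv {G : Type*} [Group G] (φ ψ : G → ℝ) (k : G) : ℝ :=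
  ∑ᶠ g, φ g * ψ (g⁻¹ * k)

/-- The square of the `l²`-norm of a finitely supported function. -/
noncomputable def sqNorm {G : Type*} (φ : G → ℝ) : ℝ :=
  ∑ᶠ g, φ g ^ 2

/-- Rapid decay of `G` with respect to the length function `L`. (A `GroupSeminorm` is exactly a
length function: subadditive, symmetric, zero at `1`; non-negativity follows.) -/
def HasRD {G : Type*} [Group G] (L : GroupSeminorm G) : Prop :=
  ∃ P : Polynomial ℝ, NonnegCoeffs P ∧
    ∀ r : ℝ, 0 < r → ∀ φ ψ : G → ℝ, (∀ g, 0 ≤ φ g) → (∀ g, 0 ≤ ψ g) →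
      φ.support.Finite → ψ.support.Finite → (∀ g, φ g ≠ 0 → L g ≤ r) →
        sqNorm (groupConv φ ψ) ≤ P.eval r * sqNorm φ * sqNorm ψ

/-! ### The relative centroid property -/

/-- Point stabilizers are finite, of uniformly bounded size. -/
def IsAlmostFree (G X : Type*) [Group G] [MulAction G X] : Prop :=
  ∃ N : ℕ, ∀ x : X, Finite (MulAction.stabilizer G x) ∧ Nat.card (MulAction.stabilizer G x) ≤ N

/-- `rc` is a relative centroid map for the length function `L` on `G`, the space of centroids `X`
and the sets of triples `T i`. -/
def IsRelativeCentroidMap {G X ι : Type*} [Group G] (L : GroupSeminorm G) [PseudoMetricSpace X]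
    [MulAction G X] (T : ι → Set (X × X × X)) (rc : G → G → X × X × X) : Prop :=
  (∀ g k, ∃ i, rc g k ∈ T i) ∧
  ∃ P : Polynomial ℝ, NonnegCoeffs P ∧
    (∀ (k : G) (r : ℝ), 0 ≤ r →
      CountLE {p : X × X | ∃ (g : G) (β : X), L g ≤ r ∧ rc g k = (p.1, β, p.2)} (P.eval r)) ∧
    (∀ g : G,
      CountLE {p : X × X | ∃ (k : G) (γ : X), rc g k = (p.1, p.2, γ)} (P.eval (L g))) ∧
    (∀ (h : G) (r : ℝ), 0 ≤ r →
      CountLE {p : X × X | ∃ (g : G) (α β γ : X), L g ≤ r ∧ rc g (g * h) = (α, β, γ) ∧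
        p = (g⁻¹ • β, g⁻¹ • γ)} (P.eval r)) ∧
    (∀ (g k : G) (α β γ : X), rc g k = (α, β, γ) →
      dist α β ≤ P.eval (L g) ∧ dist α γ ≤ P.eval (L k) ∧ dist β γ ≤ P.eval (L (g⁻¹ * k)))

/-- The relative centroid property of `(G, L)` with space of centroids `X` and finitely many
`G`-invariant sets of triples `T i`. -/
def HasRelativeCentroidProperty {G : Type*} (X : Type*) {ι : Type*} [Finite ι] [Group G]
    (L : GroupSeminorm G) [PseudoMetricSpace X] [MulAction G X] (T : ι → Set (X × X × X)) : Prop :=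
  IsIsometricSMul G X ∧ IsAlmostFree G X ∧
  (∀ (i : ι) (g : G) (x y z : X), (x, y, z) ∈ T i → (g • x, g • y, g • z) ∈ T i) ∧
  ∃ rc : G → G → X × X × X, IsRelativeCentroidMap L T rc

/-- The set of triples `G · H³ = {(g h₁, g h₂, g h₃)}`. -/
def subgroupTriples {G : Type*} [Group G] (H : Subgroup G) : Set (G × G × G) :=
  {t | ∃ g : G, ∃ h₁ ∈ H, ∃ h₂ ∈ H, ∃ h₃ ∈ H, t = (g * h₁, g * h₂, g * h₃)}

/-- The distance `dist a b = L (a⁻¹ * b)` on `G`. -/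
abbrev lengthDist {G : Type*} [Group G] (L : GroupSeminorm G) : PseudoMetricSpace G :=
  L.toSeminormedGroup.toPseudoMetricSpace

/-- `rc` is a relative centroid map for `(G, L)` with respect to the subgroups `H i`: the space of
centroids is `G` with the distance of `L` and left multiplication, and `T i = G · (H i)³`. -/
def IsSubgroupCentroidMap {G ι : Type*} [Group G] (L : GroupSeminorm G) (H : ι → Subgroup G)
    (rc : G → G → G × G × G) : Prop :=
  letI : PseudoMetricSpace G := lengthDist L
  IsRelativeCentroidMap L (fun i => subgroupTriples (H i)) rc

/-- The relative centroid property of `(G, L)` with respect to the subgroups `H i`. -/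
def HasSubgroupCentroidProperty {G ι : Type*} [Finite ι] [Group G] (L : GroupSeminorm G)
    (H : ι → Subgroup G) : Prop :=
  letI : PseudoMetricSpace G := lengthDist L
  HasRelativeCentroidProperty G L (fun i => subgroupTriples (H i))

/-! ### Graph products -/

/-- The normal subgroup of the free product of the `G v` generated by the commutators of elements
of vertex groups of adjacent vertices. -/
def graphRelations {V : Type*} (Γ : SimpleGraph V) (G : V → Type*) [∀ v, Group (G v)] :
    Subgroup (Monoid.CoprodI G) :=
  Subgroup.normalClosure {x | ∃ (u v : V) (a : G u) (b : G v), Γ.Adj u v ∧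
    x = Monoid.CoprodI.of a * Monoid.CoprodI.of b * (Monoid.CoprodI.of a)⁻¹ *
      (Monoid.CoprodI.of b)⁻¹}

instance graphRelations_normal {V : Type*} (Γ : SimpleGraph V) (G : V → Type*)
    [∀ v, Group (G v)] : (graphRelations Γ G).Normal := by
  unfold graphRelations
  infer_instance

/-- The graph product of the groups `G v` over the graph `Γ`. -/
abbrev GraphProduct {V : Type*} (Γ : SimpleGraph V) (G : V → Type*) [∀ v, Group (G v)] : Type _ :=
  Monoid.CoprodI G ⧸ graphRelations Γ G

namespace GraphProduct

variable {V : Type*} (Γ : SimpleGraph V) {G : V → Type*} [∀ v, Group (G v)]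

/-- The canonical map of a vertex group to the graph product. -/
def of (v : V) : G v →* GraphProduct Γ G :=
  (QuotientGroup.mk' (graphRelations Γ G)).comp Monoid.CoprodI.of

/-- The word `w = (g₁, …, gₘ)` of nontrivial syllables `gᵢ ∈ G vᵢ`, `vᵢ ≠ vᵢ₊₁`, represents `g`. -/
def Represents (w : Monoid.CoprodI.Word G) (g : GraphProduct Γ G) : Prop :=
  (w.toList.map fun s => of Γ s.1 s.2).prod = g

/-- Every element is represented by some word. -/
theorem exists_represents (g : GraphProduct Γ G) :
    ∃ w : Monoid.CoprodI.Word G, Represents Γ w g := by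
  classical
  obtain ⟨x, rfl⟩ := QuotientGroup.mk'_surjective (graphRelations Γ G) g
  obtain ⟨w, rfl⟩ := (Monoid.CoprodI.Word.equiv (M := G)).symm.surjective x
  refine ⟨w, ?_⟩
  change _ = QuotientGroup.mk' (graphRelations Γ G) w.prod
  rw [Monoid.CoprodI.Word.prod, map_list_prod, List.map_map]
  rfl

/-- The syllable length `λ(g)`: the least number of syllables in a word representing `g`. -/
noncomputable def syllableLength (g : GraphProduct Γ G) : ℕ :=
  sInf {m | ∃ w : Monoid.CoprodI.Word G, Represents Γ w g ∧ w.toList.length = m}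

/-- `w` is a reduced representation of `g`: one with the least number of syllables. -/
def IsReduced (w : Monoid.CoprodI.Word G) (g : GraphProduct Γ G) : Prop :=
  Represents Γ w g ∧ w.toList.length = syllableLength Γ g

/-- Every element has a reduced representation. -/
theorem exists_isReduced (g : GraphProduct Γ G) :
    ∃ w : Monoid.CoprodI.Word G, IsReduced Γ w g := by
  obtain ⟨w, hw⟩ := exists_represents Γ g
  exact Nat.sInf_mem (s := {m | ∃ w : Monoid.CoprodI.Word G, Represents Γ w g ∧
    w.toList.length = m}) ⟨_, w, hw, rfl⟩

/-- `L (g₁ ⋯ gₘ) = ∑ L_{vᵢ} (gᵢ) + λ(g)` for every reduced representation `g = g₁ ⋯ gₘ`. Since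
reduced representations exist, this determines `L`. -/
def IsGraphProductLength (Lv : ∀ v, GroupSeminorm (G v)) (L : GraphProduct Γ G → ℝ) : Prop :=
  ∀ (g : GraphProduct Γ G) (w : Monoid.CoprodI.Word G), IsReduced Γ w g →
    L g = (w.toList.map fun s => Lv s.1 s.2).sum + syllableLength Γ g

/-- The subgroup `G_C` generated by the vertex groups `G v`, `v ∈ C`. -/
def vertexSubgroup (C : Finset V) : Subgroup (GraphProduct Γ G) :=
  ⨆ v ∈ C, (of (G := G) Γ v).range

/-- `g = g₁ s₁ w` and `g⁻¹ k = w⁻¹ s₂ h₁` are factorizations (syllable lengths add up) through the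
clique `C`, such that all cancellation in the product `g (g⁻¹ k) = k` is that of `w` and the
merging of `s₁` with `s₂`; `k = g₁ (s₁ s₂) h₁` is then a factorization as well. -/
structure IsCliqueFactorization (g k : GraphProduct Γ G) (C : Finset V)
    (g₁ s₁ w s₂ h₁ : GraphProduct Γ G) : Prop where
  isClique : Γ.IsClique (C : Set V)
  mem₁ : s₁ ∈ vertexSubgroup Γ C
  mem₂ : s₂ ∈ vertexSubgroup Γ C
  length_s₁ : syllableLength Γ s₁ = C.card
  length_s₂ : syllableLength Γ s₂ = C.card
  length_s : syllableLength Γ (s₁ * s₂) = C.card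
  eq_g : g = g₁ * s₁ * w
  length_g : syllableLength Γ g = syllableLength Γ g₁ + syllableLength Γ s₁ + syllableLength Γ w
  eq_h : g⁻¹ * k = w⁻¹ * s₂ * h₁
  length_h : syllableLength Γ (g⁻¹ * k) =
    syllableLength Γ w⁻¹ + syllableLength Γ s₂ + syllableLength Γ h₁
  length_k : syllableLength Γ k =
    syllableLength Γ g₁ + syllableLength Γ (s₁ * s₂) + syllableLength Γ h₁
  cancellation : syllableLength Γ g + syllableLength Γ (g⁻¹ * k) =
    syllableLength Γ k + (C.card + 2 * syllableLength Γ w)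

/-- For all `g, k` the triple `rc g k` is `(g₁, g₁ s₁, g₁ s₁ s₂)` for some clique factorization. -/
def IsCliqueCentroidMap
    (rc : GraphProduct Γ G → GraphProduct Γ G →
      GraphProduct Γ G × GraphProduct Γ G × GraphProduct Γ G) : Prop :=
  ∀ g k, ∃ (C : Finset V) (g₁ s₁ w s₂ h₁ : GraphProduct Γ G),
    IsCliqueFactorization Γ g k C g₁ s₁ w s₂ h₁ ∧ rc g k = (g₁, g₁ * s₁, g₁ * s₁ * s₂)

end GraphProduct

/-! Everything rests on a normal form. Call a word irreducible if its syllables are nontrivial and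
no two syllables at one vertex can be brought together by commutations. The graph product acts on
irreducible words modulo shuffling, each vertex group multiplying the syllable that can be moved to
the front. Applied to the empty word, the product of an irreducible word gives back that word, so
irreducible words are unique up to shuffling (`IsIrred.shuffleEquiv`). Hence they are exactly the
shortest words, the multiset of syllables depends only on the element, and `L` is well defined. It
is subadditive because a concatenation can be reduced without raising its cost (`exists_isIrred`).

The same uniqueness controls prefixes. A prefix of `g` is determined by its numbers of syllables at
the vertices, so there are at most `(r + 1) ^ |V|` prefixes with at most `r` syllables
(`countLE_prefixes`). This is the only source of the counting bounds.

For the centroids, start with the product of `g` and `g⁻¹ k`. As long as it is not reduced, either a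
pair of syllables in the middle cancels and is moved into `w`, or a syllable at the end of the left
part meets one at the start of the right part, and the pair joins the middle. A new pair commutes
with all pairs already there, so the middle is always supported on a clique
(`IsPartialFactorization.exists_complete`). In the end `g₁` and `g₁ s₁` are prefixes of `g`, `g₁`
and `g₁ s₁ s₂` are prefixes of `k`, and `w⁻¹` and `w⁻¹ s₂` are prefixes of `g⁻¹ k`. Prefix counting
then gives `(rc₁)` to `(rc₃)`, and additivity of `L` along factorizations gives `(rc₄)`.

For rapid decay, split the convolution at `k` according to the clique and to `(g₁, s₁ s₂, h₁)`, of
which there are polynomially many for a given `k`. With these fixed, Cauchy–Schwarz removes `w`, and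
what remains is a convolution of norms over the direct product of the vertex groups
(`conv_le_sum_clique`). Rapid decay passes to finite direct products by Minkowski's inequality
(`ConvBound.prod`, `ConvBound.pi`). Conversely, it passes from the graph product to the embedded
vertex groups. -/

namespace GraphProduct

/-! ### Words up to shuffling. -/

section Words

variable {V : Type*} (Γ : SimpleGraph V) {G : V → Type*}

open Classical in
/-- The subword of the syllables at the vertices `u` and `v`. -/
noncomputable def pairProj (u v : V) (w : List (Σ v, G v)) : List (Σ v, G v) :=
  w.filter fun s => s.1 = u ∨ s.1 = v

/-- Two words are shuffle equivalent if they have the same projections to all pairs of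
non-adjacent vertices. -/
def ShuffleEquiv (w w' : List (Σ v, G v)) : Prop :=
  ∀ u v, ¬Γ.Adj u v → pairProj u v w = pairProj u v w'

theorem pairProj_append (u v : V) (w w' : List (Σ v, G v)) :
    pairProj u v (w ++ w') = pairProj u v w ++ pairProj u v w' := by
  simp [pairProj]

theorem pairProj_cons_of_mem {u v : V} {s : Σ v, G v} (h : s.1 = u ∨ s.1 = v)
    (w : List (Σ v, G v)) : pairProj u v (s :: w) = s :: pairProj u v w := by
  simp [pairProj, h]

theorem pairProj_cons_of_not_mem {u v : V} {s : Σ v, G v} (h : ¬(s.1 = u ∨ s.1 = v))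
    (w : List (Σ v, G v)) : pairProj u v (s :: w) = pairProj u v w := by
  simp [pairProj, h]

variable {Γ}

theorem pairProj_eq_nil {u v : V} (huv : ¬Γ.Adj u v) {s : Σ v, G v} (hs : s.1 = u ∨ s.1 = v)
    {l : List (Σ v, G v)} (hl : ∀ a ∈ l, Γ.Adj a.1 s.1) : pairProj u v l = [] := by
  simp only [pairProj, List.filter_eq_nil_iff, decide_eq_true_eq]
  intro a ha h
  have := hl a ha
  rcases h with h | h <;> rcases hs with hs | hs <;> rw [h, hs] at this
  · exact Γ.irrefl this
  · exact huv this
  · exact huv this.symm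
  · exact Γ.irrefl this

namespace ShuffleEquiv

theorem refl (w : List (Σ v, G v)) : ShuffleEquiv Γ w w := fun _ _ _ => rfl

theorem symm {w w' : List (Σ v, G v)} (h : ShuffleEquiv Γ w w') : ShuffleEquiv Γ w' w :=
  fun u v huv => (h u v huv).symm

theorem trans {w w' w'' : List (Σ v, G v)} (h : ShuffleEquiv Γ w w')
    (h' : ShuffleEquiv Γ w' w'') : ShuffleEquiv Γ w w'' :=
  fun u v huv => (h u v huv).trans (h' u v huv)

theorem append {w₁ w₁' w₂ w₂' : List (Σ v, G v)} (h₁ : ShuffleEquiv Γ w₁ w₁')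
    (h₂ : ShuffleEquiv Γ w₂ w₂') : ShuffleEquiv Γ (w₁ ++ w₂) (w₁' ++ w₂') := fun u v huv => by
  rw [pairProj_append, pairProj_append, h₁ u v huv, h₂ u v huv]

theorem cons (s : Σ v, G v) {w w' : List (Σ v, G v)} (h : ShuffleEquiv Γ w w') :
    ShuffleEquiv Γ (s :: w) (s :: w') :=
  append (w₁ := [s]) (w₁' := [s]) (refl _) h

theorem move_front {l : List (Σ v, G v)} {s : Σ v, G v} (hl : ∀ a ∈ l, Γ.Adj a.1 s.1)
    (w : List (Σ v, G v)) : ShuffleEquiv Γ (l ++ s :: w) (s :: (l ++ w)) := fun u v huv => by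
  rw [pairProj_append]
  by_cases hs : s.1 = u ∨ s.1 = v
  · rw [pairProj_cons_of_mem hs, pairProj_cons_of_mem hs, pairProj_append,
      pairProj_eq_nil huv hs hl]
    rfl
  · rw [pairProj_cons_of_not_mem hs, pairProj_cons_of_not_mem hs, pairProj_append]

theorem swap {s t : Σ v, G v} (h : Γ.Adj s.1 t.1) (w : List (Σ v, G v)) :
    ShuffleEquiv Γ (s :: t :: w) (t :: s :: w) :=
  move_front (l := [s]) (by simpa using h) w

/-- The first syllable of a word can be found in every equivalent word, preceded only by syllables
at adjacent vertices. -/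
theorem exists_of_cons {s : Σ v, G v} {w w' : List (Σ v, G v)} (h : ShuffleEquiv Γ (s :: w) w') :
    ∃ l w'', w' = l ++ s :: w'' ∧ (∀ a ∈ l, Γ.Adj a.1 s.1) ∧ ShuffleEquiv Γ w (l ++ w'') := by
  classical
  -- A vertex is not adjacent to itself, so the projection to the single vertex of `s` is preserved;
  -- it locates the first syllable of `w'` at that vertex.
  have h₁ := (h s.1 s.1 Γ.irrefl).symm
  rw [pairProj_cons_of_mem (Or.inl rfl), pairProj, List.filter_eq_cons_iff] at h₁
  obtain ⟨l, w'', rfl, hl, -, -⟩ := h₁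
  have hadj : ∀ a ∈ l, Γ.Adj a.1 s.1 := by
    intro a ha
    by_contra hna
    -- Otherwise the projection of `w'` to these two vertices would begin with a syllable of `l`,
    -- whereas that of `s :: w` begins with `s`.
    have h₂ := h a.1 s.1 hna
    rw [pairProj_cons_of_mem (Or.inr rfl), pairProj_append] at h₂
    have ha' : a ∈ pairProj a.1 s.1 l := by simp [pairProj, ha]
    obtain ⟨b, m, hbm⟩ := List.exists_cons_of_ne_nil (List.ne_nil_of_mem ha')
    rw [hbm, List.cons_append, List.cons.injEq] at h₂
    have hb : b ∈ l := by
      have : b ∈ pairProj a.1 s.1 l := by simp [hbm]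
      exact (List.mem_filter.1 this).1
    apply hl b hb
    simp [h₂.1]
  refine ⟨l, w'', rfl, hadj, fun u v huv => ?_⟩
  have h₂ := (h.trans (move_front hadj w'')) u v huv
  by_cases hs : s.1 = u ∨ s.1 = v
  · rw [pairProj_cons_of_mem hs, pairProj_cons_of_mem hs] at h₂
    exact (List.cons.inj h₂).2
  · rwa [pairProj_cons_of_not_mem hs, pairProj_cons_of_not_mem hs] at h₂

theorem eq_nil {w : List (Σ v, G v)} (h : ShuffleEquiv Γ [] w) : w = [] := by
  rcases w with _ | ⟨s, w⟩
  · rfl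
  · have := h s.1 s.1 Γ.irrefl
    simp [pairProj] at this

theorem cons_cancel {v : V} {b b' : G v} {w w' : List (Σ v, G v)}
    (h : ShuffleEquiv Γ (⟨v, b⟩ :: w) (⟨v, b'⟩ :: w')) : b = b' ∧ ShuffleEquiv Γ w w' := by
  obtain ⟨l, w'', h₁, hl, h₂⟩ := h.exists_of_cons
  rcases l with _ | ⟨a, l⟩
  · simp only [List.nil_append, List.cons.injEq, Sigma.mk.injEq, heq_eq_eq, true_and] at h₁
    exact ⟨h₁.1.symm, h₁.2 ▸ h₂⟩
  · rw [List.cons_append, List.cons.injEq] at h₁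
    have := hl a (by simp)
    rw [← h₁.1] at this
    exact absurd this Γ.irrefl

theorem perm {w w' : List (Σ v, G v)} (h : ShuffleEquiv Γ w w') : w.Perm w' := by
  induction w generalizing w' with
  | nil => rw [h.eq_nil]
  | cons s w ih =>
    obtain ⟨l, w'', rfl, -, h₂⟩ := h.exists_of_cons
    exact ((ih h₂).cons s).trans List.perm_middle.symm

end ShuffleEquiv

/-! ### Reduced words -/

variable (Γ)

/-- The vertex `v` occurs in the list, preceded only by adjacent vertices. -/
def Frontable (v : V) : List V → Prop
  | [] => False
  | u :: l => u = v ∨ Γ.Adj u v ∧ Frontable v l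

/-- No two occurrences of a vertex are separated by adjacent vertices only. -/
def ReducedShape : List V → Prop
  | [] => True
  | v :: l => ¬Frontable Γ v l ∧ ReducedShape l

variable {Γ}

theorem frontable_iff {v : V} {l : List V} :
    Frontable Γ v l ↔ ∃ a c, l = a ++ v :: c ∧ ∀ u ∈ a, Γ.Adj u v := by
  induction l with
  | nil => simp [Frontable]
  | cons u l ih =>
    rw [Frontable, ih]
    constructor
    · rintro (rfl | ⟨h, a, c, rfl, ha⟩)
      · exact ⟨[], l, rfl, by simp⟩
      · exact ⟨u :: a, c, rfl, by simpa [h] using ha⟩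
    · rintro ⟨_ | ⟨b, a⟩, c, h, ha⟩
      · exact Or.inl (List.cons.inj h).1
      · obtain ⟨rfl, rfl⟩ := List.cons.inj h
        exact Or.inr ⟨ha u (by simp), a, c, rfl, fun x hx => ha x (by simp [hx])⟩

theorem frontable_map_iff {v : V} {w : List (Σ v, G v)} :
    Frontable Γ v (w.map Sigma.fst) ↔
      ∃ l b w', w = l ++ ⟨v, b⟩ :: w' ∧ ∀ a ∈ l, Γ.Adj a.1 v := by
  rw [frontable_iff]
  constructor
  · rintro ⟨a, c, h, ha⟩
    obtain ⟨l, w', rfl, rfl, h'⟩ := List.map_eq_append_iff.1 h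
    obtain ⟨⟨_, b⟩, w', rfl, rfl, rfl⟩ := List.map_eq_cons_iff.1 h'
    exact ⟨l, b, w', rfl, fun a h => ha _ (List.mem_map_of_mem h)⟩
  · rintro ⟨l, b, w', rfl, h⟩
    exact ⟨l.map Sigma.fst, w'.map Sigma.fst, by simp, List.forall_mem_map.2 h⟩

theorem frontable_iff_exists_equiv {v : V} {w : List (Σ v, G v)} :
    Frontable Γ v (w.map Sigma.fst) ↔ ∃ b w', ShuffleEquiv Γ w (⟨v, b⟩ :: w') := by
  rw [frontable_map_iff]
  constructor
  · rintro ⟨l, b, w', rfl, h⟩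
    exact ⟨b, l ++ w', .move_front h w'⟩
  · rintro ⟨b, w', h⟩
    obtain ⟨l, w'', h₁, h₂, -⟩ := h.symm.exists_of_cons
    exact ⟨l, b, w'', h₁, h₂⟩

theorem ShuffleEquiv.frontable {v : V} {w w' : List (Σ v, G v)} (h : ShuffleEquiv Γ w w')
    (hw : Frontable Γ v (w.map Sigma.fst)) : Frontable Γ v (w'.map Sigma.fst) := by
  rw [frontable_iff_exists_equiv] at hw ⊢
  obtain ⟨b, w'', h'⟩ := hw
  exact ⟨b, w'', h.symm.trans h'⟩

theorem Frontable.of_cons {v : V} {s : Σ v, G v} (hs : s.1 ≠ v) {w : List (Σ v, G v)}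
    (h : Frontable Γ v ((s :: w).map Sigma.fst)) :
    Γ.Adj s.1 v ∧ Frontable Γ v (w.map Sigma.fst) := by
  rw [List.map_cons, Frontable] at h
  tauto

/-- If `w = s :: w₁` and `w' = t :: l ++ s :: w''`, the induction is used twice: for `w'` without
`s`, which is equivalent to `w₁`, and for `w'` without `t`. Induction on the length allows both. -/
theorem ShuffleEquiv.reducedShape {w w' : List (Σ v, G v)} (h : ShuffleEquiv Γ w w')
    (hw : ReducedShape Γ (w.map Sigma.fst)) : ReducedShape Γ (w'.map Sigma.fst) := by
  induction hn : w'.length generalizing w w' with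
  | zero =>
    rw [List.length_eq_zero_iff] at hn
    subst hn
    trivial
  | succ n ih =>
    obtain ⟨t, w₁', rfl⟩ := List.exists_cons_of_length_eq_add_one hn
    obtain ⟨s, w, rfl⟩ : ∃ s w₁, w = s :: w₁ := by
      rcases w with _ | ⟨s, w₁⟩
      · simpa using h.eq_nil
      · exact ⟨s, w₁, rfl⟩
    obtain ⟨hsF, hwR⟩ := hw
    have hn' : w₁'.length = n := by simpa using hn
    obtain ⟨l, w'', h₁, hl, h₂⟩ := h.exists_of_cons
    rcases l with _ | ⟨a, l⟩
    · obtain ⟨rfl, rfl⟩ := List.cons.inj h₁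
      exact ⟨fun hF => hsF (h₂.symm.frontable hF), ih h₂ hwR hn'⟩
    · obtain ⟨rfl, rfl⟩ := List.cons.inj h₁
      have hts : Γ.Adj t.1 s.1 := hl t (by simp)
      have hl' : ∀ a ∈ l, Γ.Adj a.1 s.1 := fun a ha => hl a (by simp [ha])
      have hlen : (l ++ w'').length + 1 = n := by
        rw [← hn']
        simp
        omega
      obtain ⟨htF, hR⟩ : ReducedShape Γ ((t :: (l ++ w'')).map Sigma.fst) :=
        ih h₂ hwR (by simpa using hlen)
      have hmove : ShuffleEquiv Γ (s :: (l ++ w'')) (l ++ s :: w'') :=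
        (ShuffleEquiv.move_front hl' w'').symm
      refine ⟨fun hF => htF ?_, ih hmove ⟨fun hF => hsF ?_, hR⟩ hn'⟩
      · exact ((hmove.symm.frontable hF).of_cons hts.ne').2
      · exact h₂.symm.frontable (Or.inr ⟨hts, hF⟩)

theorem not_frontable_of_clique {v : V} {l : List V} (h : ∀ u ∈ l, Γ.Adj v u) :
    ¬Frontable Γ v l := by
  rw [frontable_iff]
  rintro ⟨a, c, rfl, -⟩
  exact Γ.irrefl (h v (by simp))

theorem reducedShape_of_pairwise_adj {l : List V} (h : l.Pairwise Γ.Adj) : ReducedShape Γ l := by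
  induction l with
  | nil => trivial
  | cons v l ih =>
    rw [List.pairwise_cons] at h
    exact ⟨not_frontable_of_clique h.1, ih h.2⟩

/-- If two concatenations of shapes are reduced and that of all three is not, then some
vertices of the outer shapes meet. -/
theorem exists_of_not_reducedShape {A B C : List V} (hAB : ReducedShape Γ (A ++ B))
    (hBC : ReducedShape Γ (B ++ C)) (h : ¬ReducedShape Γ (A ++ (B ++ C))) :
    ∃ v A₁ A₂ C₁ C₂, A = A₁ ++ v :: A₂ ∧ C = C₁ ++ v :: C₂ ∧ (∀ u ∈ A₂, Γ.Adj u v) ∧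
      (∀ u ∈ B, Γ.Adj u v) ∧ ∀ u ∈ C₁, Γ.Adj u v := by
  induction A with
  | nil => exact absurd hBC h
  | cons s A ih =>
    obtain ⟨hs, hAB⟩ := hAB
    by_cases hR : ReducedShape Γ (A ++ (B ++ C))
    · have hF : Frontable Γ s (A ++ (B ++ C)) := by
        by_contra hF
        exact h ⟨hF, hR⟩
      rw [frontable_iff] at hF hs
      obtain ⟨a, c, hac, ha⟩ := hF
      -- The occurrence of `s` that meets the first one cannot lie in `A ++ B`, by `hs`. So it lies
      -- in `C`, and all that is in between is adjacent to `s`.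
      rw [← List.append_assoc, List.append_eq_append_iff] at hac
      rcases hac with ⟨d, rfl, hd⟩ | ⟨d, hd, hd'⟩
      · refine ⟨s, [], A, d, c, rfl, hd, fun u hu => ha u ?_, fun u hu => ha u ?_,
          fun u hu => ha u ?_⟩ <;> simp [hu]
      · rcases d with _ | ⟨x, d⟩
        · refine ⟨s, [], A, [], c, rfl, by simpa using hd'.symm, fun u hu => ha u ?_,
            fun u hu => ha u ?_, by simp⟩ <;> rw [List.append_nil] at hd <;> rw [← hd] <;>
            simp [hu]
        · obtain ⟨rfl, -⟩ := List.cons.inj hd'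
          exact absurd ⟨a, d, hd, ha⟩ hs
    · obtain ⟨v, A₁, A₂, C₁, C₂, rfl, h'⟩ := ih hAB hR
      exact ⟨v, s :: A₁, A₂, C₁, C₂, rfl, h'⟩

end Words

end GraphProduct

namespace GraphProduct

/-! ### Uniqueness of irreducible words. -/

section NormalForm

variable {V : Type*} (Γ : SimpleGraph V) {G : V → Type*} [∀ v, Group (G v)]

/-- The product of a word in the graph product. -/
def wordProd (w : List (Σ v, G v)) : GraphProduct Γ G :=
  (w.map fun s => of Γ s.1 s.2).prod

@[simp]
theorem wordProd_nil : wordProd Γ ([] : List (Σ v, G v)) = 1 := rfl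

@[simp]
theorem wordProd_cons (s : Σ v, G v) (w : List (Σ v, G v)) :
    wordProd Γ (s :: w) = of Γ s.1 s.2 * wordProd Γ w := by
  simp [wordProd]

@[simp]
theorem wordProd_append (w w' : List (Σ v, G v)) :
    wordProd Γ (w ++ w') = wordProd Γ w * wordProd Γ w' := by
  simp [wordProd]

variable {Γ}

theorem commute_of {u v : V} (h : Γ.Adj u v) (a : G u) (b : G v) :
    Commute (of Γ u a) (of Γ v b) := by
  have h₁ : (Monoid.CoprodI.of a * Monoid.CoprodI.of b * (Monoid.CoprodI.of a)⁻¹ *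
      (Monoid.CoprodI.of b)⁻¹ : Monoid.CoprodI G) ∈ graphRelations Γ G :=
    Subgroup.subset_normalClosure ⟨u, v, a, b, h, rfl⟩
  have h₂ := (QuotientGroup.eq_one_iff _).2 h₁
  change of Γ u a * of Γ v b * (of Γ u a)⁻¹ * (of Γ v b)⁻¹ = 1 at h₂
  rwa [mul_inv_eq_one, mul_inv_eq_iff_eq_mul] at h₂

theorem commute_wordProd_of {v : V} {l : List (Σ v, G v)} (hl : ∀ a ∈ l, Γ.Adj a.1 v) (b : G v) :
    Commute (wordProd Γ l) (of Γ v b) := by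
  refine Commute.list_prod_left _ _ fun x hx => ?_
  obtain ⟨a, ha, rfl⟩ := List.mem_map.1 hx
  exact commute_of (hl a ha) _ _

theorem wordProd_move_front {l : List (Σ v, G v)} {s : Σ v, G v} (hl : ∀ a ∈ l, Γ.Adj a.1 s.1)
    (w : List (Σ v, G v)) :
    wordProd Γ (l ++ s :: w) = of Γ s.1 s.2 * wordProd Γ (l ++ w) := by
  rw [wordProd_append, wordProd_cons, wordProd_append, ← mul_assoc,
    (commute_wordProd_of hl s.2).eq, mul_assoc]

theorem ShuffleEquiv.wordProd_eq {w w' : List (Σ v, G v)} (h : ShuffleEquiv Γ w w') :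
    wordProd Γ w = wordProd Γ w' := by
  induction w generalizing w' with
  | nil => rw [h.eq_nil]
  | cons s w ih =>
    obtain ⟨l, w'', rfl, hl, h₂⟩ := h.exists_of_cons
    rw [wordProd_move_front hl, wordProd_cons, ih h₂]

variable (Γ) in
/-- A word of nontrivial syllables without possible cancellation or merging. -/
def IsIrred (w : List (Σ v, G v)) : Prop :=
  (∀ s ∈ w, s.2 ≠ 1) ∧ ReducedShape Γ (w.map Sigma.fst)

theorem isIrred_nil : IsIrred Γ ([] : List (Σ v, G v)) :=
  ⟨by simp, trivial⟩

theorem isIrred_cons {s : Σ v, G v} {w : List (Σ v, G v)} :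
    IsIrred Γ (s :: w) ↔ s.2 ≠ 1 ∧ ¬Frontable Γ s.1 (w.map Sigma.fst) ∧ IsIrred Γ w := by
  simp only [IsIrred, List.forall_mem_cons, List.map_cons, ReducedShape]
  tauto

theorem ShuffleEquiv.isIrred {w w' : List (Σ v, G v)} (h : ShuffleEquiv Γ w w')
    (hw : IsIrred Γ w) : IsIrred Γ w' :=
  ⟨fun s hs => hw.1 s (h.perm.mem_iff.2 hs), h.reducedShape hw.2⟩

open Classical in
/-- Prepend a syllable, unless it is trivial. -/
noncomputable def consNe (v : V) (b : G v) (w : List (Σ v, G v)) : List (Σ v, G v) :=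
  if b = 1 then w else ⟨v, b⟩ :: w

@[simp]
theorem consNe_one (v : V) (w : List (Σ v, G v)) : consNe v 1 w = w := by
  simp [consNe]

theorem consNe_of_ne {v : V} {b : G v} (hb : b ≠ 1) (w : List (Σ v, G v)) :
    consNe v b w = ⟨v, b⟩ :: w := by
  simp [consNe, hb]

@[simp]
theorem wordProd_consNe (v : V) (b : G v) (w : List (Σ v, G v)) :
    wordProd Γ (consNe v b w) = of Γ v b * wordProd Γ w := by
  by_cases hb : b = 1
  · simp [hb]
  · simp [consNe_of_ne hb]

theorem IsIrred.consNe {v : V} {w : List (Σ v, G v)} (hw : IsIrred Γ w)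
    (hF : ¬Frontable Γ v (w.map Sigma.fst)) (b : G v) : IsIrred Γ (consNe v b w) := by
  by_cases hb : b = 1
  · simpa [hb] using hw
  · rw [consNe_of_ne hb]
    exact isIrred_cons.2 ⟨hb, hF, hw⟩

theorem ShuffleEquiv.consNe {v : V} {w w' : List (Σ v, G v)} (h : ShuffleEquiv Γ w w') (b : G v) :
    ShuffleEquiv Γ (consNe v b w) (consNe v b w') := by
  by_cases hb : b = 1
  · simpa [hb] using h
  · simpa [consNe_of_ne hb] using h.cons _

theorem consNe_swap {u v : V} (h : Γ.Adj u v) (a : G u) (b : G v) (w : List (Σ v, G v)) :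
    ShuffleEquiv Γ (consNe u a (consNe v b w)) (consNe v b (consNe u a w)) := by
  by_cases ha : a = 1
  · simpa [ha] using ShuffleEquiv.refl _
  by_cases hb : b = 1
  · simpa [hb] using ShuffleEquiv.refl _
  simp only [consNe_of_ne ha, consNe_of_ne hb]
  exact ShuffleEquiv.swap h w

theorem not_frontable_consNe {u v : V} (huv : u ≠ v) {w : List (Σ v, G v)}
    (h : ¬Frontable Γ v (w.map Sigma.fst)) (a : G u) :
    ¬Frontable Γ v ((consNe u a w).map Sigma.fst) := by
  by_cases ha : a = 1
  · simpa [ha] using h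
  · rw [consNe_of_ne ha]
    exact fun hF => h (hF.of_cons huv).2

theorem Frontable.consNe {u v : V} (huv : Γ.Adj u v) {w : List (Σ v, G v)}
    (h : Frontable Γ v (w.map Sigma.fst)) (a : G u) :
    Frontable Γ v ((GraphProduct.consNe u a w).map Sigma.fst) := by
  by_cases ha : a = 1
  · simpa [ha] using h
  · rw [consNe_of_ne ha]
    exact Or.inr ⟨huv, h⟩

/-- Admitting `b = 1` treats words with and without a front syllable at `v` alike. With the
uniqueness in `ShuffleEquiv.split_unique`, each trace has a well-defined coordinate in `G v`, on
which `G v` acts by left multiplication. -/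
theorem IsIrred.exists_split {w : List (Σ v, G v)} (hw : IsIrred Γ w) (v : V) :
    ∃ (b : G v) (w₀ : List (Σ v, G v)), IsIrred Γ w₀ ∧ ¬Frontable Γ v (w₀.map Sigma.fst) ∧
      ShuffleEquiv Γ w (GraphProduct.consNe v b w₀) := by
  by_cases hF : Frontable Γ v (w.map Sigma.fst)
  · obtain ⟨b, w₀, h⟩ := frontable_iff_exists_equiv.1 hF
    obtain ⟨hb, hF₀, hw₀⟩ := isIrred_cons.1 (h.isIrred hw)
    exact ⟨b, w₀, hw₀, hF₀, by rwa [consNe_of_ne hb]⟩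
  · exact ⟨1, w, hw, hF, by simpa using ShuffleEquiv.refl w⟩

theorem ShuffleEquiv.split_unique {v : V} {b b' : G v} {w w' : List (Σ v, G v)}
    (hF : ¬Frontable Γ v (w.map Sigma.fst)) (hF' : ¬Frontable Γ v (w'.map Sigma.fst))
    (h : ShuffleEquiv Γ (GraphProduct.consNe v b w) (GraphProduct.consNe v b' w')) :
    b = b' ∧ ShuffleEquiv Γ w w' := by
  by_cases hb : b = 1 <;> by_cases hb' : b' = 1
  · subst hb hb'
    simpa using h
  · subst hb
    rw [consNe_one, consNe_of_ne hb'] at h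
    exact absurd (frontable_iff_exists_equiv.2 ⟨_, _, h⟩) hF
  · subst hb'
    rw [consNe_one, consNe_of_ne hb] at h
    exact absurd (frontable_iff_exists_equiv.2 ⟨_, _, h.symm⟩) hF'
  · rw [consNe_of_ne hb, consNe_of_ne hb'] at h
    exact h.cons_cancel

/-! ### The action on irreducible words -/

variable (Γ G) in
/-- Shuffle equivalence of irreducible words. -/
def irredSetoid : Setoid {w : List (Σ v, G v) // IsIrred Γ w} where
  r w w' := ShuffleEquiv Γ w.1 w'.1
  iseqv := ⟨fun _ => .refl _, .symm, .trans⟩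

variable (Γ G) in
/-- Irreducible words up to shuffle equivalence. -/
abbrev Trace : Type _ := Quotient (irredSetoid Γ G)

/-- The class of an irreducible word. -/
def IsIrred.trace {w : List (Σ v, G v)} (hw : IsIrred Γ w) : Trace Γ G :=
  Quotient.mk (irredSetoid Γ G) ⟨w, hw⟩

theorem IsIrred.trace_eq_iff {w w' : List (Σ v, G v)} (hw : IsIrred Γ w) (hw' : IsIrred Γ w') :
    hw.trace = hw'.trace ↔ ShuffleEquiv Γ w w' :=
  Quotient.eq (r := irredSetoid Γ G)

theorem Trace.exists_split (τ : Trace Γ G) (v : V) :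
    ∃ (b : G v) (w : List (Σ v, G v)) (hw : IsIrred Γ w)
      (hF : ¬Frontable Γ v (w.map Sigma.fst)), τ = (hw.consNe hF b).trace := by
  induction τ using Quotient.inductionOn with
  | h w =>
    obtain ⟨b, w₀, hw₀, hF, h⟩ := w.2.exists_split v
    exact ⟨b, w₀, hw₀, hF, (w.2.trace_eq_iff _).2 h⟩

/-- Left multiplication of a trace by an element of a vertex group. -/
noncomputable def Trace.act (v : V) (x : G v) (τ : Trace Γ G) : Trace Γ G :=
  ((τ.exists_split v).choose_spec.choose_spec.choose.consNe
    (τ.exists_split v).choose_spec.choose_spec.choose_spec.choose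
    (x * (τ.exists_split v).choose)).trace

/-- The action is defined through a chosen splitting; uniqueness allows any other to be used for
computing it. -/
theorem Trace.act_trace {v : V} (x b : G v) {w : List (Σ v, G v)} (hw : IsIrred Γ w)
    (hF : ¬Frontable Γ v (w.map Sigma.fst)) :
    Trace.act v x (hw.consNe hF b).trace = (hw.consNe hF (x * b)).trace := by
  have h := ((hw.consNe hF b).trace.exists_split v).choose_spec.choose_spec.choose_spec.choose_spec
  rw [IsIrred.trace_eq_iff] at h
  obtain ⟨h₁, h₂⟩ := h.split_unique hF
    ((hw.consNe hF b).trace.exists_split v).choose_spec.choose_spec.choose_spec.choose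
  rw [Trace.act, IsIrred.trace_eq_iff]
  refine (h₂.symm.consNe _).trans ?_
  rw [← h₁]
  exact .refl _

/-- The action of a vertex group on traces. -/
noncomputable def Trace.actHom (v : V) : G v →* Function.End (Trace Γ G) where
  toFun := Trace.act v
  map_one' := by
    funext τ
    obtain ⟨b, w, hw, hF, rfl⟩ := τ.exists_split v
    change Trace.act v 1 _ = (hw.consNe hF b).trace
    rw [Trace.act_trace 1 b hw hF, IsIrred.trace_eq_iff, one_mul]
    exact .refl _
  map_mul' x y := by
    funext τ
    obtain ⟨b, w, hw, hF, rfl⟩ := τ.exists_split v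
    change Trace.act v (x * y) _ = Trace.act v x (Trace.act v y _)
    rw [Trace.act_trace y b hw hF, Trace.act_trace x (y * b) hw hF,
      Trace.act_trace (x * y) b hw hF, IsIrred.trace_eq_iff, mul_assoc]
    exact .refl _

theorem Trace.commute_actHom {u v : V} (huv : Γ.Adj u v) (x : G u) (y : G v) :
    Commute (Trace.actHom (Γ := Γ) u x) (Trace.actHom (Γ := Γ) v y) := by
  funext τ
  change Trace.act u x (Trace.act v y τ) = Trace.act v y (Trace.act u x τ)
  obtain ⟨b, w, hw, hF, rfl⟩ := τ.exists_split v
  -- Splitting off both vertices leaves `w₀` with two independent coordinates `b` and `c`, which can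
  -- be put in front in either order.
  obtain ⟨c, w₀, hw₀, hF₀, h⟩ := hw.exists_split u
  have hFv : ¬Frontable Γ v (w₀.map Sigma.fst) := fun h' =>
    hF (h.symm.frontable (h'.consNe huv c))
  have hFc (c : G u) := not_frontable_consNe huv.ne hFv c
  have hFb (b : G v) := not_frontable_consNe huv.ne' hF₀ b
  have e₁ (b : G v) (c : G u) : ((hw₀.consNe hF₀ c).consNe (hFc c) b).trace =
      ((hw₀.consNe hFv b).consNe (hFb b) c).trace :=
    (IsIrred.trace_eq_iff _ _).2 (consNe_swap huv.symm b c w₀)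
  have e₂ : (hw.consNe hF b).trace = ((hw₀.consNe hF₀ c).consNe (hFc c) b).trace :=
    (IsIrred.trace_eq_iff _ _).2 (h.consNe b)
  have e₃ (b : G v) (c : G u) := Trace.act_trace y b (hw₀.consNe hF₀ c) (hFc c)
  have e₄ (b : G v) (c : G u) := Trace.act_trace x c (hw₀.consNe hFv b) (hFb b)
  rw [e₂, e₃, e₁, e₄, e₁, e₄, ← e₁ b (x * c), e₃, e₁]

variable (Γ G) in
/-- The action of the graph product on traces. -/
noncomputable def traceHom : GraphProduct Γ G →* Function.End (Trace Γ G) :=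
  QuotientGroup.lift (graphRelations Γ G) (Monoid.CoprodI.lift Trace.actHom) <| by
    refine Subgroup.normalClosure_le_normal ?_
    rintro _ ⟨u, v, a, b, h, rfl⟩
    rw [SetLike.mem_coe, MonoidHom.mem_ker, map_mul, map_mul, map_mul, ← map_inv, ← map_inv,
      Monoid.CoprodI.lift_of, Monoid.CoprodI.lift_of, Monoid.CoprodI.lift_of,
      Monoid.CoprodI.lift_of, (Trace.commute_actHom h a b).eq, mul_assoc (Trace.actHom v b),
      ← map_mul, mul_inv_cancel, map_one, mul_one, ← map_mul, mul_inv_cancel, map_one]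

theorem traceHom_of (v : V) (x : G v) : traceHom Γ G (of Γ v x) = Trace.act v x := by
  change Monoid.CoprodI.lift Trace.actHom (Monoid.CoprodI.of x) = _
  rw [Monoid.CoprodI.lift_of]
  rfl

theorem IsIrred.traceHom_wordProd {w : List (Σ v, G v)} (hw : IsIrred Γ w) :
    traceHom Γ G (wordProd Γ w) isIrred_nil.trace = hw.trace := by
  induction w with
  | nil =>
    rw [wordProd_nil, map_one]
    rfl
  | cons s w ih =>
    obtain ⟨hs, hF, hw'⟩ := isIrred_cons.1 hw
    rw [wordProd_cons, map_mul, traceHom_of]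
    change Trace.act s.1 s.2 (traceHom Γ G (wordProd Γ w) isIrred_nil.trace) = _
    rw [ih hw']
    have h := Trace.act_trace s.2 1 hw' hF
    simp only [consNe_one, mul_one, consNe_of_ne hs] at h
    exact h

/-- Irreducible words with the same product are shuffle equivalent. -/
theorem IsIrred.shuffleEquiv {w w' : List (Σ v, G v)} (hw : IsIrred Γ w) (hw' : IsIrred Γ w')
    (h : wordProd Γ w = wordProd Γ w') : ShuffleEquiv Γ w w' := by
  rw [← hw.trace_eq_iff hw', ← hw.traceHom_wordProd, ← hw'.traceHom_wordProd, h]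

end NormalForm

end GraphProduct

namespace GraphProduct

/-! ### Syllable length, the length function and prefixes. -/

section Length

variable {V : Type*} (Γ : SimpleGraph V) {G : V → Type*} [∀ v, Group (G v)]

/-- The sum of the lengths of the syllables. -/
def wordCost (Lv : ∀ v, GroupSeminorm (G v)) (w : List (Σ v, G v)) : ℝ :=
  (w.map fun s => Lv s.1 s.2).sum

@[simp]
theorem wordCost_nil (Lv : ∀ v, GroupSeminorm (G v)) : wordCost Lv [] = 0 := rfl

@[simp]
theorem wordCost_cons (Lv : ∀ v, GroupSeminorm (G v)) (s : Σ v, G v) (w : List (Σ v, G v)) :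
    wordCost Lv (s :: w) = Lv s.1 s.2 + wordCost Lv w := by
  simp [wordCost]

@[simp]
theorem wordCost_append (Lv : ∀ v, GroupSeminorm (G v)) (w w' : List (Σ v, G v)) :
    wordCost Lv (w ++ w') = wordCost Lv w + wordCost Lv w' := by
  simp [wordCost]

theorem wordCost_perm (Lv : ∀ v, GroupSeminorm (G v)) {w w' : List (Σ v, G v)} (h : w.Perm w') :
    wordCost Lv w = wordCost Lv w' :=
  (h.map _).sum_eq

theorem wordCost_nonneg (Lv : ∀ v, GroupSeminorm (G v)) (w : List (Σ v, G v)) :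
    0 ≤ wordCost Lv w := by
  refine List.sum_nonneg fun x hx => ?_
  obtain ⟨s, -, rfl⟩ := List.mem_map.1 hx
  exact apply_nonneg (Lv s.1) s.2

theorem wordCost_consNe (Lv : ∀ v, GroupSeminorm (G v)) (v : V) (b : G v) (w : List (Σ v, G v)) :
    wordCost Lv (consNe v b w) = Lv v b + wordCost Lv w := by
  by_cases hb : b = 1
  · subst hb
    simp
  · simp [consNe_of_ne hb]

theorem length_le_length_consNe (v : V) (b : G v) (w : List (Σ v, G v)) :
    w.length ≤ (consNe v b w).length := by
  by_cases hb : b = 1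
  · simp [hb]
  · simp [consNe_of_ne hb]

theorem length_consNe_le (v : V) (b : G v) (w : List (Σ v, G v)) :
    (consNe v b w).length ≤ w.length + 1 := by
  by_cases hb : b = 1
  · simp [hb]
  · simp [consNe_of_ne hb]

variable {Γ}

/-- Every word can be reduced to an irreducible one, without increasing its cost. -/
theorem exists_isIrred (Lv : ∀ v, GroupSeminorm (G v)) (w : List (Σ v, G v)) :
    ∃ w', IsIrred Γ w' ∧ wordProd Γ w' = wordProd Γ w ∧ w'.length ≤ w.length ∧
      wordCost Lv w' ≤ wordCost Lv w ∧ (¬IsIrred Γ w → w'.length < w.length) := by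
  induction w with
  | nil => exact ⟨[], isIrred_nil, rfl, le_rfl, le_rfl, fun h => absurd isIrred_nil h⟩
  | cons s w ih =>
    obtain ⟨w', hw', hprod, hlen, hcost, hlt⟩ := ih
    -- `s` merges with the front syllable `b` of the reduced tail, where `b = 1` if there is none.
    obtain ⟨b, w₀, hw₀, hF, he⟩ := hw'.exists_split s.1
    have hl := he.perm.length_eq
    have h₁ := length_le_length_consNe s.1 b w₀
    have h₂ := length_consNe_le s.1 (s.2 * b) w₀
    refine ⟨consNe s.1 (s.2 * b) w₀, hw₀.consNe hF _, ?_, ?_, ?_, fun hn => ?_⟩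
    · rw [wordProd_cons, ← hprod, he.wordProd_eq, wordProd_consNe, wordProd_consNe, map_mul,
        mul_assoc]
    · rw [List.length_cons]
      omega
    · rw [wordCost_perm Lv he.perm, wordCost_consNe] at hcost
      rw [wordCost_consNe, wordCost_cons]
      have := map_mul_le_add (Lv s.1) s.2 b
      linarith
    · rw [List.length_cons]
      by_cases hw : IsIrred Γ w
      · by_cases hs : s.2 = 1
        · rw [hs, one_mul]
          omega
        -- An irreducible tail and a nontrivial `s` leave merging as the only obstruction, so `b` is
        -- a genuine syllable and a syllable is saved.
        · have hFs : Frontable Γ s.1 (w.map Sigma.fst) := by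
            by_contra hFs
            exact hn (isIrred_cons.2 ⟨hs, hFs, hw⟩)
          have hb : b ≠ 1 := by
            rintro rfl
            rw [consNe_one] at he
            exact hF (he.frontable ((hw.shuffleEquiv hw' hprod.symm).frontable hFs))
          rw [consNe_of_ne hb, List.length_cons] at hl
          omega
      · have := hlt hw
        omega

theorem IsIrred.isChain {w : List (Σ v, G v)} (hw : IsIrred Γ w) :
    w.IsChain fun l l' => l.1 ≠ l'.1 := by
  induction w with
  | nil => simp
  | cons s w ih =>
    obtain ⟨-, hF, hw'⟩ := isIrred_cons.1 hw
    rcases w with _ | ⟨t, w⟩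
    · simp
    · rw [List.isChain_cons_cons]
      exact ⟨fun h => hF (Or.inl h.symm), ih hw'⟩

/-- A shortest word reduces to an irreducible one with no more syllables, and that one is a
permutation of `w`. -/
theorem IsIrred.syllableLength_eq {w : List (Σ v, G v)} (hw : IsIrred Γ w) :
    syllableLength Γ (wordProd Γ w) = w.length := by
  refine le_antisymm (Nat.sInf_le ⟨⟨w, hw.1, hw.isChain⟩, rfl, rfl⟩) ?_
  obtain ⟨w₀, h, hl⟩ := exists_isReduced Γ (wordProd Γ w)
  obtain ⟨w', hw', hp, hl', -⟩ := exists_isIrred (Γ := Γ) (fun _ => 0) w₀.toList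
  rw [← hl, (hw.shuffleEquiv hw' (h.symm.trans hp.symm)).perm.length_eq]
  exact hl'

theorem syllableLength_wordProd_le (w : List (Σ v, G v)) :
    syllableLength Γ (wordProd Γ w) ≤ w.length := by
  obtain ⟨w', hw', hp, hl', -⟩ := exists_isIrred (Γ := Γ) (fun _ => 0) w
  rw [← hp, hw'.syllableLength_eq]
  exact hl'

/-- Translates additivity of syllable lengths in a product into irreducibility of the concatenated
words, and back. -/
theorem isIrred_iff {w : List (Σ v, G v)} :
    IsIrred Γ w ↔ w.length ≤ syllableLength Γ (wordProd Γ w) := by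
  refine ⟨fun hw => hw.syllableLength_eq.ge, fun h => ?_⟩
  obtain ⟨w', hw', hp, -, -, hl⟩ := exists_isIrred (Γ := Γ) (fun _ => 0) w
  rw [← hp, hw'.syllableLength_eq] at h
  by_contra hw
  exact absurd (hl hw) h.not_gt

variable (Γ) in
theorem exists_normalForm (g : GraphProduct Γ G) :
    ∃ w : List (Σ v, G v), IsIrred Γ w ∧ wordProd Γ w = g := by
  obtain ⟨w, hw⟩ := exists_represents Γ g
  obtain ⟨w', hw', hp, -⟩ := exists_isIrred (Γ := Γ) (fun _ => 0) w.toList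
  exact ⟨w', hw', hp.trans hw⟩

/-- An irreducible word representing the given element. -/
noncomputable def normalForm (g : GraphProduct Γ G) : List (Σ v, G v) :=
  (exists_normalForm Γ g).choose

theorem isIrred_normalForm (g : GraphProduct Γ G) : IsIrred Γ (normalForm g) :=
  (exists_normalForm Γ g).choose_spec.1

@[simp]
theorem wordProd_normalForm (g : GraphProduct Γ G) : wordProd Γ (normalForm g) = g :=
  (exists_normalForm Γ g).choose_spec.2

theorem length_normalForm (g : GraphProduct Γ G) :
    (normalForm g).length = syllableLength Γ g := by
  rw [← (isIrred_normalForm g).syllableLength_eq, wordProd_normalForm]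

theorem syllableLength_mul_le (g h : GraphProduct Γ G) :
    syllableLength Γ (g * h) ≤ syllableLength Γ g + syllableLength Γ h := by
  have := syllableLength_wordProd_le (Γ := Γ) (normalForm g ++ normalForm h)
  simpa [length_normalForm] using this

theorem syllableLength_one : syllableLength Γ (1 : GraphProduct Γ G) = 0 :=
  Nat.le_zero.1 (syllableLength_wordProd_le [])

theorem syllableLength_of_le (v : V) (x : G v) : syllableLength Γ (of Γ v x) ≤ 1 := by
  have := syllableLength_wordProd_le (Γ := Γ) [⟨v, x⟩]
  simpa using this

/-- The word of the inverse. -/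
def invWord (w : List (Σ v, G v)) : List (Σ v, G v) :=
  (w.map fun s => ⟨s.1, s.2⁻¹⟩).reverse

theorem wordProd_invWord (w : List (Σ v, G v)) :
    wordProd Γ (invWord w) = (wordProd Γ w)⁻¹ := by
  induction w with
  | nil => simp [invWord]
  | cons s w ih =>
    have : invWord (s :: w) = invWord w ++ [⟨s.1, s.2⁻¹⟩] := by simp [invWord]
    rw [this, wordProd_append, ih]
    simp

theorem wordCost_invWord (Lv : ∀ v, GroupSeminorm (G v)) (w : List (Σ v, G v)) :
    wordCost Lv (invWord w) = wordCost Lv w := by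
  rw [invWord, wordCost_perm Lv (List.reverse_perm _)]
  simp [wordCost, Function.comp_def]

theorem syllableLength_inv (g : GraphProduct Γ G) :
    syllableLength Γ g⁻¹ = syllableLength Γ g := by
  have key (g : GraphProduct Γ G) : syllableLength Γ g⁻¹ ≤ syllableLength Γ g := by
    have := syllableLength_wordProd_le (Γ := Γ) (invWord (normalForm g))
    rw [wordProd_invWord, wordProd_normalForm] at this
    simpa [invWord, length_normalForm] using this
  refine le_antisymm (key g) ?_
  simpa using key g⁻¹

theorem isIrred_append_normalForm {g h : GraphProduct Γ G}
    (hgh : syllableLength Γ g + syllableLength Γ h ≤ syllableLength Γ (g * h)) :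
    IsIrred Γ (normalForm g ++ normalForm h) := by
  rw [isIrred_iff]
  simpa [length_normalForm] using hgh

/-! ### The length function -/

theorem wordCost_eq_of_isIrred (Lv : ∀ v, GroupSeminorm (G v)) {w : List (Σ v, G v)}
    (hw : IsIrred Γ w) : wordCost Lv (normalForm (wordProd Γ w)) = wordCost Lv w :=
  wordCost_perm Lv ((isIrred_normalForm _).shuffleEquiv hw (by simp)).perm

theorem wordCost_normalForm_le (Lv : ∀ v, GroupSeminorm (G v)) (w : List (Σ v, G v)) :
    wordCost Lv (normalForm (wordProd Γ w)) ≤ wordCost Lv w := by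
  obtain ⟨w', hw', hp, -, hc, -⟩ := exists_isIrred (Γ := Γ) Lv w
  rw [← hp, wordCost_eq_of_isIrred Lv hw']
  exact hc

variable (Γ) in
/-- The length function of the graph product. -/
noncomputable def length (Lv : ∀ v, GroupSeminorm (G v)) : GroupSeminorm (GraphProduct Γ G) where
  toFun g := wordCost Lv (normalForm g) + syllableLength Γ g
  map_one' := by
    have h := wordCost_eq_of_isIrred (Γ := Γ) Lv isIrred_nil
    rw [wordProd_nil] at h
    rw [h, syllableLength_one]
    simp
  mul_le' g h := by
    have h₁ := wordCost_normalForm_le (Γ := Γ) Lv (normalForm g ++ normalForm h)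
    have h₂ : (syllableLength Γ (g * h) : ℝ) ≤ syllableLength Γ g + syllableLength Γ h := by
      exact_mod_cast syllableLength_mul_le g h
    simp only [wordProd_append, wordProd_normalForm, wordCost_append] at h₁
    linarith
  inv' g := by
    have key (g : GraphProduct Γ G) :
        wordCost Lv (normalForm g⁻¹) ≤ wordCost Lv (normalForm g) := by
      have := wordCost_normalForm_le (Γ := Γ) Lv (invWord (normalForm g))
      rwa [wordProd_invWord, wordCost_invWord, wordProd_normalForm] at this
    have h := key g⁻¹
    rw [inv_inv] at h
    rw [syllableLength_inv, le_antisymm (key g) h]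

theorem length_apply (Lv : ∀ v, GroupSeminorm (G v)) (g : GraphProduct Γ G) :
    length Γ Lv g = wordCost Lv (normalForm g) + syllableLength Γ g := rfl

theorem length_wordProd (Lv : ∀ v, GroupSeminorm (G v)) {w : List (Σ v, G v)}
    (hw : IsIrred Γ w) : length Γ Lv (wordProd Γ w) = wordCost Lv w + w.length := by
  rw [length_apply, wordCost_eq_of_isIrred Lv hw, hw.syllableLength_eq]

theorem isGraphProductLength_length (Lv : ∀ v, GroupSeminorm (G v)) :
    IsGraphProductLength Γ Lv (length Γ Lv) := by
  rintro g w ⟨rfl, hl⟩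
  rw [← hl]
  exact length_wordProd Lv (isIrred_iff.2 hl.le)

theorem syllableLength_le_length (Lv : ∀ v, GroupSeminorm (G v)) (g : GraphProduct Γ G) :
    (syllableLength Γ g : ℝ) ≤ length Γ Lv g := by
  rw [length_apply]
  have := wordCost_nonneg Lv (normalForm g)
  linarith

theorem eq_one_of_length_eq_zero (Lv : ∀ v, GroupSeminorm (G v)) {g : GraphProduct Γ G}
    (hg : length Γ Lv g = 0) : g = 1 := by
  have h := syllableLength_le_length Lv g
  rw [hg, ← length_normalForm] at h
  have h₀ : (normalForm g).length = 0 := by exact_mod_cast h.antisymm (Nat.cast_nonneg _)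
  rw [← wordProd_normalForm g, List.length_eq_zero_iff.1 h₀, wordProd_nil]

theorem length_mul_of_add_le (Lv : ∀ v, GroupSeminorm (G v)) {g h : GraphProduct Γ G}
    (hgh : syllableLength Γ g + syllableLength Γ h ≤ syllableLength Γ (g * h)) :
    length Γ Lv (g * h) = length Γ Lv g + length Γ Lv h := by
  have h₁ := length_wordProd Lv (isIrred_append_normalForm hgh)
  simp only [wordProd_append, wordProd_normalForm, wordCost_append, List.length_append,
    length_normalForm, Nat.cast_add] at h₁
  rw [h₁, length_apply, length_apply]
  ring

theorem length_of_le (Lv : ∀ v, GroupSeminorm (G v)) (v : V) (x : G v) :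
    length Γ Lv (of Γ v x) ≤ Lv v x + 1 := by
  have h₁ := wordCost_normalForm_le (Γ := Γ) Lv [⟨v, x⟩]
  have h₂ : (syllableLength Γ (of Γ v x) : ℝ) ≤ 1 := by exact_mod_cast syllableLength_of_le v x
  simp only [wordProd_cons, wordProd_nil, mul_one, wordCost_cons, wordCost_nil, add_zero] at h₁
  rw [length_apply]
  linarith

theorem of_injective (v : V) : Function.Injective (of (G := G) Γ v) := by
  rw [injective_iff_map_eq_one]
  intro x hx
  by_contra hne
  have hw : IsIrred Γ [(⟨v, x⟩ : Σ v, G v)] := isIrred_cons.2 ⟨hne, by simp [Frontable], isIrred_nil⟩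
  have h := hw.syllableLength_eq
  simp [hx, syllableLength_one] at h

/-! ### Counting prefixes -/

variable (Γ G) in
/-- The prefixes of `g` of syllable length at most `r`. -/
def prefixes (g : GraphProduct Γ G) (r : ℝ) : Set (GraphProduct Γ G) :=
  {a | syllableLength Γ a + syllableLength Γ (a⁻¹ * g) ≤ syllableLength Γ g ∧
    (syllableLength Γ a : ℝ) ≤ r}

open Classical in
/-- The number of syllables of the normal form at the vertex `v`. -/
noncomputable def syllableCount (g : GraphProduct Γ G) (v : V) : ℕ :=
  ((normalForm g).map Sigma.fst).count v

theorem syllableCount_le (g : GraphProduct Γ G) (v : V) :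
    syllableCount g v ≤ syllableLength Γ g := by
  classical
  rw [← length_normalForm, ← List.length_map (as := normalForm g) Sigma.fst]
  exact List.count_le_length

theorem length_pairProj_normalForm (g : GraphProduct Γ G) (u v : V) :
    (pairProj u v (normalForm g)).length =
      open Classical in if u = v then syllableCount g u else syllableCount g u + syllableCount g v := by
  classical
  rw [pairProj, syllableCount, syllableCount]
  induction normalForm g with
  | nil => simp
  | cons s w ih =>
    rw [List.filter_cons, List.map_cons, List.count_cons, List.count_cons]
    simp only [beq_iff_eq, decide_eq_true_eq]
    split_ifs at * <;> simp_all <;> omega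

/-- A prefix is determined by the numbers of its syllables at the vertices. -/
theorem prefix_eq_of_syllableCount {g a b : GraphProduct Γ G} {r s : ℝ}
    (ha : a ∈ prefixes Γ G g r) (hb : b ∈ prefixes Γ G g s)
    (h : ∀ v, syllableCount a v = syllableCount b v) : a = b := by
  have hirr {a : GraphProduct Γ G} {r : ℝ} (ha : a ∈ prefixes Γ G g r) :
      IsIrred Γ (normalForm a ++ normalForm (a⁻¹ * g)) :=
    isIrred_append_normalForm (by simpa using ha.1)
  have h₁ := (hirr ha).shuffleEquiv (hirr hb) (by simp)
  have h₂ : ShuffleEquiv Γ (normalForm a) (normalForm b) := fun u v huv => by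
    have h₃ := h₁ u v huv
    rw [pairProj_append, pairProj_append] at h₃
    -- Both projections are initial segments of the same list, and equal syllable counts give them
    -- equal lengths.
    refine (List.append_inj h₃ ?_).1
    rw [length_pairProj_normalForm, length_pairProj_normalForm, h u, h v]
  simpa using h₂.wordProd_eq

/-- The vector of syllable counts embeds these prefixes into the box `{0, …, ⌊r⌋} ^ V`. -/
theorem countLE_prefixes [Finite V] (g : GraphProduct Γ G) {r : ℝ} (hr : 0 ≤ r) :
    CountLE (prefixes Γ G g r) ((r + 1) ^ Nat.card V) := by
  classical
  have := Fintype.ofFinite V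
  let T : Set (V → ℕ) := Set.pi Set.univ fun _ => Set.Iic ⌊r⌋₊
  have hT : T.Finite := Set.Finite.pi fun _ => Set.finite_Iic _
  have hmaps : Set.MapsTo syllableCount (prefixes Γ G g r) T := fun a ha v _ =>
    (syllableCount_le a v).trans (Nat.le_floor ha.2)
  have hinj : Set.InjOn syllableCount (prefixes Γ G g r) := fun a ha b hb hab =>
    prefix_eq_of_syllableCount ha hb (congrFun hab)
  refine ⟨Set.Finite.of_injOn hmaps hinj hT, ?_⟩
  have h₁ := Set.ncard_le_ncard_of_injOn syllableCount hmaps hinj hT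
  have h₂ : T.ncard = (⌊r⌋₊ + 1) ^ Nat.card V := by
    have : T = (Fintype.piFinset fun _ : V => Finset.Iic ⌊r⌋₊ : Finset (V → ℕ)) := by
      ext f
      simp [T]
    rw [this, Set.ncard_coe_finset, Fintype.card_piFinset]
    simp
  calc ((prefixes Γ G g r).ncard : ℝ) ≤ ((⌊r⌋₊ + 1) ^ Nat.card V : ℕ) := by
        exact_mod_cast h₂ ▸ h₁
    _ ≤ (r + 1) ^ Nat.card V := by
        push_cast
        gcongr
        exact Nat.floor_le hr

end Length

end GraphProduct

namespace GraphProduct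

/-! ### Clique factorizations. -/

section Clique

variable {V : Type*} {G : V → Type*}

/-- The word with syllables `t v` at the vertices `v` of the list `l`. -/
def familyWord (l : List V) (t : ∀ v, G v) : List (Σ v, G v) :=
  l.map fun v => ⟨v, t v⟩

@[simp]
theorem length_familyWord (l : List V) (t : ∀ v, G v) : (familyWord l t).length = l.length := by
  simp [familyWord]

@[simp]
theorem map_fst_familyWord (l : List V) (t : ∀ v, G v) :
    (familyWord l t).map Sigma.fst = l := by
  simp [familyWord, Function.comp_def]

variable (Γ : SimpleGraph V) [∀ v, Group (G v)]

/-- The product of the `t v` for the vertices `v` of the list `l`. -/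
def familyProd (l : List V) (t : ∀ v, G v) : GraphProduct Γ G :=
  wordProd Γ (familyWord l t)

@[simp]
theorem familyProd_cons (v : V) (l : List V) (t : ∀ v, G v) :
    familyProd Γ (v :: l) t = of Γ v (t v) * familyProd Γ l t := by
  simp [familyProd, familyWord]

theorem familyProd_congr {l : List V} {t t' : ∀ v, G v} (h : ∀ v ∈ l, t v = t' v) :
    familyProd Γ l t = familyProd Γ l t' := by
  have : familyWord l t = familyWord l t' :=
    List.map_congr_left fun v hv => by rw [h v hv]
  rw [familyProd, this, familyProd]

variable {Γ}

theorem isIrred_familyWord {l : List V} {t : ∀ v, G v} (hl : l.Pairwise Γ.Adj)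
    (ht : ∀ v ∈ l, t v ≠ 1) : IsIrred Γ (familyWord l t) :=
  ⟨List.forall_mem_map.2 ht, by
    rw [map_fst_familyWord]
    exact reducedShape_of_pairwise_adj hl⟩

theorem syllableLength_familyProd {l : List V} {t : ∀ v, G v} (hl : l.Pairwise Γ.Adj)
    (ht : ∀ v ∈ l, t v ≠ 1) : syllableLength Γ (familyProd Γ l t) = l.length := by
  rw [familyProd, (isIrred_familyWord hl ht).syllableLength_eq, length_familyWord]

theorem commute_familyProd_of {v : V} {l : List V} (hl : ∀ u ∈ l, Γ.Adj u v) (t : ∀ v, G v)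
    (b : G v) : Commute (familyProd Γ l t) (of Γ v b) :=
  commute_wordProd_of (List.forall_mem_map.2 hl) b

theorem familyProd_mul {l : List V} (hl : l.Pairwise Γ.Adj) (t t' : ∀ v, G v) :
    familyProd Γ l (t * t') = familyProd Γ l t * familyProd Γ l t' := by
  induction l with
  | nil => simp [familyProd, familyWord]
  | cons v l ih =>
    rw [List.pairwise_cons] at hl
    have hc := commute_familyProd_of (fun u hu => (hl.1 u hu).symm) t (t' v)
    rw [familyProd_cons, familyProd_cons, familyProd_cons, ih hl.2, Pi.mul_apply, map_mul,
      mul_assoc, mul_assoc, ← mul_assoc (familyProd Γ l t), hc.eq, mul_assoc]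

theorem familyProd_middle {v : V} {l l' : List V} (hl : (l ++ v :: l').Pairwise Γ.Adj)
    (t : ∀ v, G v) :
    familyProd Γ (l ++ v :: l') t = of Γ v (t v) * familyProd Γ (l ++ l') t := by
  have h : ∀ u ∈ l, Γ.Adj u v := fun u hu => (List.pairwise_append.1 hl).2.2 u hu v (by simp)
  have := wordProd_move_front (Γ := Γ) (l := familyWord l t) (s := ⟨v, t v⟩)
    (List.forall_mem_map.2 h) (familyWord l' t)
  simpa [familyProd, familyWord] using this

theorem adj_of_pairwise_middle {v : V} {l l' : List V} (hl : (l ++ v :: l').Pairwise Γ.Adj) :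
    ∀ u ∈ l ++ l', Γ.Adj u v := by
  rw [List.pairwise_append, List.pairwise_cons] at hl
  intro u hu
  rcases List.mem_append.1 hu with hu | hu
  · exact hl.2.2 u hu v (by simp)
  · exact (hl.2.1.1 u hu).symm

theorem familyProd_perm {l l' : List V} (h : l.Perm l') (hl : l.Pairwise Γ.Adj) (t : ∀ v, G v) :
    familyProd Γ l t = familyProd Γ l' t := by
  have hp : ((familyWord l t).map fun s => of Γ s.1 s.2).Perm
      ((familyWord l' t).map fun s => of Γ s.1 s.2) := (h.map _).map _
  refine hp.prod_eq' ?_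
  rw [familyWord, List.map_map, List.pairwise_map]
  exact hl.imp fun hab => commute_of hab _ _

theorem familyProd_mem_vertexSubgroup {l : List V} {C : Finset V} (hl : ∀ v ∈ l, v ∈ C)
    (t : ∀ v, G v) : familyProd Γ l t ∈ vertexSubgroup Γ (G := G) C := by
  induction l with
  | nil => exact one_mem _
  | cons v l ih =>
    rw [familyProd_cons]
    refine mul_mem ?_ (ih fun u hu => hl u (by simp [hu]))
    exact (le_iSup₂ (f := fun v (_ : v ∈ C) => (of (G := G) Γ v).range) v (hl v (by simp)))
      ⟨t v, rfl⟩

variable (Γ) in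
/-- A partial clique factorization: `s₁ s₂` may still be shorter than `s₁` and `s₂`, and its
product with `g₁` and `h₁` need not be reduced. -/
structure IsPartialFactorization (g h g₁ w h₁ : GraphProduct Γ G) (l : List V) (t₁ t₂ : ∀ v, G v) :
    Prop where
  pairwise : l.Pairwise Γ.Adj
  ne₁ : ∀ v ∈ l, t₁ v ≠ 1
  ne₂ : ∀ v ∈ l, t₂ v ≠ 1
  eq_g : g = g₁ * familyProd Γ l t₁ * w
  eq_h : h = w⁻¹ * familyProd Γ l t₂ * h₁
  length_g : syllableLength Γ g₁ + l.length + syllableLength Γ w ≤ syllableLength Γ g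
  length_h : syllableLength Γ w + l.length + syllableLength Γ h₁ ≤ syllableLength Γ h

namespace IsPartialFactorization

variable {g h g₁ w h₁ : GraphProduct Γ G} {l : List V} {t₁ t₂ : ∀ v, G v}

/-- A cancelling pair of syllables is moved to `w`. -/
theorem cancel {v : V} {l' : List V} (H : IsPartialFactorization Γ g h g₁ w h₁ (l ++ v :: l') t₁ t₂)
    (hv : t₁ v * t₂ v = 1) :
    IsPartialFactorization Γ g h g₁ (of Γ v (t₁ v) * w) h₁ (l ++ l') t₁ t₂ := by
  have hmem : ∀ u ∈ l ++ l', u ∈ l ++ v :: l' := fun u hu => by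
    simp only [List.mem_append, List.mem_cons] at hu ⊢
    tauto
  have hw : syllableLength Γ (of Γ v (t₁ v) * w) ≤ 1 + syllableLength Γ w :=
    (syllableLength_mul_le _ _).trans (Nat.add_le_add_right (syllableLength_of_le _ _) _)
  have hlen : (l ++ v :: l').length = (l ++ l').length + 1 := by
    simp
    omega
  have hg := H.length_g
  have hh := H.length_h
  have hc := commute_familyProd_of (adj_of_pairwise_middle H.pairwise) t₁ (t₁ v)
  have hv' : of Γ v (t₂ v) = (of Γ v (t₁ v))⁻¹ := by
    rw [← map_inv, eq_inv_of_mul_eq_one_right hv]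
  refine ⟨H.pairwise.sublist (List.Sublist.append_left (List.sublist_cons_self v l') l),
    fun u hu => H.ne₁ u (hmem u hu), fun u hu => H.ne₂ u (hmem u hu), ?_, ?_, ?_, ?_⟩
  · rw [H.eq_g, familyProd_middle H.pairwise, ← hc.eq]
    simp only [mul_assoc]
  · rw [H.eq_h, familyProd_middle H.pairwise, hv', mul_inv_rev]
    simp only [mul_assoc]
  · omega
  · omega

/-- A merging pair of syllables of `g₁` and `h₁` is added to the clique. -/
theorem merge {v : V} {x y : G v} {A₁ A₂ C₁ C₂ : List (Σ v, G v)}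
    (H : IsPartialFactorization Γ g h g₁ w h₁ l t₁ t₂)
    (hA : normalForm g₁ = A₁ ++ ⟨v, x⟩ :: A₂) (hC : normalForm h₁ = C₁ ++ ⟨v, y⟩ :: C₂)
    (hA₂ : ∀ a ∈ A₂, Γ.Adj a.1 v) (hl : ∀ u ∈ l, Γ.Adj u v) (hC₁ : ∀ a ∈ C₁, Γ.Adj a.1 v) :
    ∃ g₁' h₁' t₁' t₂', IsPartialFactorization Γ g h g₁' w h₁' (v :: l) t₁' t₂' ∧
      syllableLength Γ g₁' < syllableLength Γ g₁ := by
  classical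
  -- All of `l` is adjacent to `v`, so `v` is not in `l` and its coordinate is free to hold the new
  -- syllable.
  have hupd (t : ∀ v, G v) (z : G v) :
      familyProd Γ l (Function.update t v z) = familyProd Γ l t :=
    familyProd_congr Γ fun u hu => Function.update_of_ne (hl u hu).ne _ _
  have hne {t : ∀ v, G v} {z : G v} (hz : z ≠ 1) (ht : ∀ u ∈ l, t u ≠ 1) :
      ∀ u ∈ v :: l, Function.update t v z u ≠ 1 := by
    intro u hu
    rcases List.mem_cons.1 hu with rfl | hu
    · simpa using hz
    · rw [Function.update_of_ne (hl u hu).ne]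
      exact ht u hu
  have hx : x ≠ 1 := (isIrred_normalForm g₁).1 ⟨v, x⟩ (by simp [hA])
  have hy : y ≠ 1 := (isIrred_normalForm h₁).1 ⟨v, y⟩ (by simp [hC])
  have hg₁ : g₁ = wordProd Γ (A₁ ++ A₂) * of Γ v x := by
    conv_lhs => rw [← wordProd_normalForm g₁, hA]
    rw [wordProd_append, wordProd_append, wordProd_cons, mul_assoc,
      (commute_wordProd_of hA₂ x).eq]
  have hh₁ : h₁ = of Γ v y * wordProd Γ (C₁ ++ C₂) := by
    conv_lhs => rw [← wordProd_normalForm h₁, hC]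
    exact wordProd_move_front hC₁ _
  have hlg : syllableLength Γ (wordProd Γ (A₁ ++ A₂)) + 1 ≤ syllableLength Γ g₁ := by
    have := syllableLength_wordProd_le (Γ := Γ) (A₁ ++ A₂)
    rw [← length_normalForm g₁, hA]
    simp only [List.length_append, List.length_cons] at this ⊢
    omega
  have hlh : syllableLength Γ (wordProd Γ (C₁ ++ C₂)) + 1 ≤ syllableLength Γ h₁ := by
    have := syllableLength_wordProd_le (Γ := Γ) (C₁ ++ C₂)
    rw [← length_normalForm h₁, hC]
    simp only [List.length_append, List.length_cons] at this ⊢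
    omega
  have hg := H.length_g
  have hh := H.length_h
  refine ⟨wordProd Γ (A₁ ++ A₂), wordProd Γ (C₁ ++ C₂), Function.update t₁ v x,
    Function.update t₂ v y, ⟨List.pairwise_cons.2 ⟨fun u hu => (hl u hu).symm, H.pairwise⟩,
      hne hx H.ne₁, hne hy H.ne₂, ?_, ?_, ?_, ?_⟩, hlg⟩
  · rw [familyProd_cons, hupd, Function.update_self, H.eq_g]
    conv_lhs => rw [hg₁]
    simp only [mul_assoc]
  · rw [familyProd_cons, hupd, Function.update_self, H.eq_h]
    conv_lhs => rw [hh₁]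
    rw [← (commute_familyProd_of hl t₂ y).eq]
    simp only [mul_assoc]
  · rw [List.length_cons]
    omega
  · rw [List.length_cons]
    omega

/-- Cancel or merge until neither is possible. A merge lowers `λ(g₁)` by at least one and lengthens
`l` by one; a cancellation shortens `l` and keeps `g₁`. So `2 λ(g₁) + |l|` drops each time. -/
theorem exists_complete (H : IsPartialFactorization Γ g h g₁ w h₁ l t₁ t₂) :
    ∃ g₁' w' h₁' l' t₁' t₂', IsPartialFactorization Γ g h g₁' w' h₁' l' t₁' t₂' ∧
      (∀ v ∈ l', t₁' v * t₂' v ≠ 1) ∧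
      syllableLength Γ g₁' + l'.length + syllableLength Γ h₁' ≤
        syllableLength Γ (g₁' * familyProd Γ l' (t₁' * t₂') * h₁') := by
  induction hn : 2 * syllableLength Γ g₁ + l.length using Nat.strong_induction_on
    generalizing g₁ w h₁ l t₁ t₂ with
  | _ n ih =>
    by_cases hcancel : ∃ v ∈ l, t₁ v * t₂ v = 1
    · obtain ⟨v, hv, hv'⟩ := hcancel
      obtain ⟨l₁, l₂, rfl⟩ := List.append_of_mem hv
      refine ih _ ?_ (H.cancel hv') rfl
      rw [← hn]
      simp
    push Not at hcancel
    by_cases hirr : ReducedShape Γ ((normalForm g₁).map Sigma.fst ++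
        (l ++ (normalForm h₁).map Sigma.fst))
    · refine ⟨g₁, w, h₁, l, t₁, t₂, H, hcancel, ?_⟩
      have h₁ : IsIrred Γ (normalForm g₁ ++ (familyWord l (t₁ * t₂) ++ normalForm h₁)) := by
        refine ⟨?_, by simpa using hirr⟩
        intro s hs
        rcases List.mem_append.1 hs with hs | hs
        · exact (isIrred_normalForm g₁).1 s hs
        rcases List.mem_append.1 hs with hs | hs
        · obtain ⟨v, hv, rfl⟩ := List.mem_map.1 hs
          exact hcancel v hv
        · exact (isIrred_normalForm _).1 s hs
      have h₂ := isIrred_iff.1 h₁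
      simp only [List.length_append, length_normalForm, length_familyWord, wordProd_append,
        wordProd_normalForm] at h₂
      rw [mul_assoc, add_assoc]
      exact h₂
    · have hg := H.length_g
      have hh := H.length_h
      -- Reducedness of a shape depends on the vertices only, so `s₁`, `s₂` and `s₁ s₂` are
      -- interchangeable in the middle. As parts of reduced products, `g₁ s₁` and `s₂ h₁` are
      -- reduced, so the obstruction joins a syllable of `g₁` to one of `h₁`.
      have hAB : ReducedShape Γ ((normalForm g₁).map Sigma.fst ++ l) := by
        have h₁ : IsIrred Γ (normalForm g₁ ++ familyWord l t₁) := by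
          rw [isIrred_iff]
          rw [H.eq_g] at hg
          have := syllableLength_mul_le (g₁ * familyProd Γ l t₁) w
          simp only [List.length_append, length_normalForm, length_familyWord, wordProd_append,
            wordProd_normalForm]
          change _ ≤ syllableLength Γ (g₁ * familyProd Γ l t₁)
          omega
        simpa using h₁.2
      have hBC : ReducedShape Γ (l ++ (normalForm h₁).map Sigma.fst) := by
        have h₁ : IsIrred Γ (familyWord l t₂ ++ normalForm h₁) := by
          rw [isIrred_iff]
          rw [H.eq_h, mul_assoc] at hh
          have := syllableLength_mul_le w⁻¹ (familyProd Γ l t₂ * h₁)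
          rw [syllableLength_inv] at this
          simp only [List.length_append, length_normalForm, length_familyWord, wordProd_append,
            wordProd_normalForm]
          change _ ≤ syllableLength Γ (familyProd Γ l t₂ * h₁)
          omega
        simpa using h₁.2
      obtain ⟨v, A₁, A₂, C₁, C₂, hA₀, hC₀, hA₂, hl, hC₁⟩ :=
        exists_of_not_reducedShape hAB hBC hirr
      obtain ⟨A₁, A, hA, rfl, hA'⟩ := List.map_eq_append_iff.1 hA₀
      obtain ⟨⟨v, x⟩, A₂, rfl, rfl, rfl⟩ := List.map_eq_cons_iff.1 hA'
      obtain ⟨C₁, C, hC, rfl, hC'⟩ := List.map_eq_append_iff.1 hC₀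
      obtain ⟨⟨_, y⟩, C₂, rfl, hvy, rfl⟩ := List.map_eq_cons_iff.1 hC'
      cases hvy
      obtain ⟨g₁', h₁', t₁', t₂', H', hlt⟩ := H.merge hA hC (List.forall_mem_map.1 hA₂) hl
        (List.forall_mem_map.1 hC₁)
      refine ih _ ?_ H' rfl
      rw [List.length_cons]
      omega

end IsPartialFactorization

/-- The families with support `C`. -/
def fullSupport (C : Finset V) : Set (∀ v, G v) :=
  {t | ∀ v, t v ≠ 1 ↔ v ∈ C}

theorem pairwise_adj_toList {C : Finset V} (hC : Γ.IsClique (C : Set V)) :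
    C.toList.Pairwise Γ.Adj :=
  C.nodup_toList.imp_of_mem fun ha hb hab =>
    hC (by simpa using ha) (by simpa using hb) hab

theorem isIrred_familyWord_toList {C : Finset V} (hC : Γ.IsClique (C : Set V)) {t : ∀ v, G v}
    (ht : t ∈ fullSupport C) : IsIrred Γ (familyWord C.toList t) :=
  isIrred_familyWord (pairwise_adj_toList hC) fun v hv => (ht v).2 (by simpa using hv)

theorem syllableLength_familyProd_toList {C : Finset V} (hC : Γ.IsClique (C : Set V))
    {t : ∀ v, G v} (ht : t ∈ fullSupport C) :
    syllableLength Γ (familyProd Γ C.toList t) = C.card := by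
  rw [familyProd, (isIrred_familyWord_toList hC ht).syllableLength_eq]
  simp

theorem familyProd_injOn {C : Finset V} (hC : Γ.IsClique (C : Set V)) :
    Set.InjOn (familyProd Γ (G := G) C.toList) (fullSupport C) := by
  intro t ht t' ht' h
  have hp := ((isIrred_familyWord_toList hC ht).shuffleEquiv
    (isIrred_familyWord_toList hC ht') h).perm
  funext v
  by_cases hv : v ∈ C
  · have : (⟨v, t v⟩ : Σ v, G v) ∈ familyWord C.toList t :=
      List.mem_map.2 ⟨v, by simpa using hv, rfl⟩
    obtain ⟨u, -, hu⟩ := List.mem_map.1 (hp.mem_iff.1 this)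
    simp only [Sigma.mk.injEq] at hu
    obtain ⟨rfl, hu⟩ := hu
    exact (eq_of_heq hu).symm
  · have h₁ : t v = 1 := by_contra fun h => hv ((ht v).1 h)
    have h₂ : t' v = 1 := by_contra fun h => hv ((ht' v).1 h)
    rw [h₁, h₂]

/-- Coordinates outside `C` are trivial and have length zero, so the bound holds at every vertex;
this lets one work in the full direct product rather than in that over `C`. -/
theorem length_le_of_family (Lv : ∀ v, GroupSeminorm (G v)) {C : Finset V}
    (hC : Γ.IsClique (C : Set V)) {t : ∀ v, G v} (ht : t ∈ fullSupport C) (v : V) :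
    Lv v (t v) ≤ length Γ Lv (familyProd Γ C.toList t) := by
  rw [familyProd, length_wordProd Lv (isIrred_familyWord_toList hC ht)]
  have hn : 0 ≤ ((familyWord C.toList t).length : ℝ) := Nat.cast_nonneg _
  by_cases hv : v ∈ C
  · have : Lv v (t v) ≤ wordCost Lv (familyWord C.toList t) := by
      refine List.single_le_sum (fun x hx => ?_) _ ?_
      · obtain ⟨s, -, rfl⟩ := List.mem_map.1 hx
        exact apply_nonneg (Lv s.1) s.2
      · exact List.mem_map.2 ⟨⟨v, t v⟩, List.mem_map.2 ⟨v, by simpa using hv, rfl⟩, rfl⟩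
    linarith
  · have h₁ : t v = 1 := by_contra fun h => hv ((ht v).1 h)
    rw [h₁, map_one_eq_zero]
    have := wordCost_nonneg Lv (familyWord C.toList t)
    linarith

/-- Clique factorizations exist. -/
theorem exists_isCliqueFactorization (g k : GraphProduct Γ G) :
    ∃ (C : Finset V) (t₁ t₂ : ∀ v, G v) (g₁ w h₁ : GraphProduct Γ G),
      t₁ ∈ fullSupport C ∧ t₂ ∈ fullSupport C ∧ t₁ * t₂ ∈ fullSupport C ∧
      IsCliqueFactorization Γ g k C g₁ (familyProd Γ C.toList t₁) w
        (familyProd Γ C.toList t₂) h₁ := by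
  classical
  -- Nothing has been cancelled or merged yet.
  have H₀ : IsPartialFactorization Γ g (g⁻¹ * k) g 1 (g⁻¹ * k) [] (fun _ => 1) (fun _ => 1) := by
    refine ⟨by simp, by simp, by simp, ?_, ?_, ?_, ?_⟩ <;>
      simp [familyProd, familyWord, syllableLength_one]
  obtain ⟨g₁, w, h₁, l, t₁, t₂, H, hne, hlen⟩ := H₀.exists_complete
  -- The coordinates outside `l` are arbitrary so far; setting them to `1` makes the support exactly
  -- the clique.
  let e (t : ∀ v, G v) (v : V) : G v := if v ∈ l then t v else 1
  have hnodup : l.Nodup := H.pairwise.imp fun h => h.ne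
  have hperm : l.toFinset.toList.Perm l := List.toFinset_toList hnodup
  have hcard : l.toFinset.card = l.length := List.toFinset_card_of_nodup hnodup
  have hclique : Γ.IsClique (l.toFinset : Set V) := by
    intro a ha b hb hab
    have : Std.Symm Γ.Adj := ⟨fun _ _ h => h.symm⟩
    exact H.pairwise.forall (by simpa using ha) (by simpa using hb) hab
  have he (t : ∀ v, G v) : familyProd Γ l.toFinset.toList (e t) = familyProd Γ l t := by
    rw [familyProd_perm hperm (pairwise_adj_toList hclique)]
    exact familyProd_congr Γ fun v hv => if_pos hv
  have hsupp {t : ∀ v, G v} (ht : ∀ v ∈ l, t v ≠ 1) : e t ∈ fullSupport l.toFinset := by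
    intro v
    by_cases hv : v ∈ l <;> simp [e, hv]
    exact ht v hv
  have hmul : e (t₁ * t₂) = e t₁ * e t₂ := by
    funext v
    by_cases hv : v ∈ l <;> simp [e, hv]
  have hs₁ := syllableLength_familyProd H.pairwise H.ne₁
  have hs₂ := syllableLength_familyProd H.pairwise H.ne₂
  have hs := syllableLength_familyProd (t := t₁ * t₂) H.pairwise hne
  have hg := H.length_g
  have hh := H.length_h
  have hk : k = g₁ * familyProd Γ l (t₁ * t₂) * h₁ := by
    have : k = g * (g⁻¹ * k) := by simp
    rw [this, H.eq_h, familyProd_mul H.pairwise]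
    conv_lhs => rw [H.eq_g]
    simp only [mul_assoc, mul_inv_cancel_left]
  -- Subadditivity turns the inequalities of the partial factorization into equalities.
  have key₃ (a b c : GraphProduct Γ G) : syllableLength Γ (a * b * c) ≤
      syllableLength Γ a + syllableLength Γ b + syllableLength Γ c :=
    (syllableLength_mul_le _ _).trans (Nat.add_le_add_right (syllableLength_mul_le _ _) _)
  have hg' := key₃ g₁ (familyProd Γ l t₁) w
  have hh' := key₃ w⁻¹ (familyProd Γ l t₂) h₁
  have hk' := key₃ g₁ (familyProd Γ l (t₁ * t₂)) h₁
  rw [← H.eq_g] at hg'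
  rw [← H.eq_h, syllableLength_inv] at hh'
  rw [← hk] at hk' hlen
  have hm := familyProd_mul H.pairwise t₁ t₂
  refine ⟨l.toFinset, e t₁, e t₂, g₁, w, h₁, hsupp H.ne₁, hsupp H.ne₂, hmul ▸ hsupp hne, ?_⟩
  rw [he, he]
  have hmem (t : ∀ v, G v) : familyProd Γ l t ∈ vertexSubgroup Γ (G := G) l.toFinset :=
    familyProd_mem_vertexSubgroup (by simp) t
  refine ⟨hclique, hmem _, hmem _, ?_, ?_, ?_, H.eq_g, ?_, H.eq_h, ?_, ?_, ?_⟩ <;>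
    simp only [← hm, hs₁, hs₂, hs, hcard, syllableLength_inv] <;> omega

end Clique

end GraphProduct

/-! ### Counting pairs, and polynomials with non-negative coefficients. -/

theorem CountLE.of_subset_prod {α β : Type*} {S : Set α} {T : Set β} {A : Set (α × β)} {a b c : ℝ}
    (hS : CountLE S a) (hT : CountLE T b) (hA : A ⊆ S ×ˢ T) (hc : a * b ≤ c) : CountLE A c := by
  have hfin := hS.1.prod hT.1
  refine ⟨hfin.subset hA, le_trans ?_ hc⟩
  calc (A.ncard : ℝ) ≤ (S ×ˢ T).ncard := by exact_mod_cast Set.ncard_le_ncard hA hfin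
    _ = S.ncard * T.ncard := by rw [Set.ncard_prod]; push_cast; rfl
    _ ≤ a * b := mul_le_mul hS.2 hT.2 (Nat.cast_nonneg _) ((Nat.cast_nonneg _).trans hS.2)

namespace NonnegCoeffs

open Polynomial

theorem add {P Q : ℝ[X]} (hP : NonnegCoeffs P) (hQ : NonnegCoeffs Q) : NonnegCoeffs (P + Q) :=
  fun n => by
    rw [coeff_add]
    exact add_nonneg (hP n) (hQ n)

theorem mul {P Q : ℝ[X]} (hP : NonnegCoeffs P) (hQ : NonnegCoeffs Q) : NonnegCoeffs (P * Q) :=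
  fun n => by
    rw [coeff_mul]
    exact Finset.sum_nonneg fun _ _ => mul_nonneg (hP _) (hQ _)

theorem C {a : ℝ} (ha : 0 ≤ a) : NonnegCoeffs (Polynomial.C a) := fun n => by
  rw [coeff_C]
  split_ifs <;> simp [ha]

theorem one : NonnegCoeffs (1 : ℝ[X]) := C zero_le_one

theorem X : NonnegCoeffs (Polynomial.X : ℝ[X]) := fun n => by
  rw [coeff_X]
  split_ifs <;> simp

theorem pow {P : ℝ[X]} (hP : NonnegCoeffs P) (n : ℕ) : NonnegCoeffs (P ^ n) := by
  induction n with
  | zero => simpa using one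
  | succ n ih =>
    rw [pow_succ]
    exact ih.mul hP

theorem prod {ι : Type*} (s : Finset ι) {P : ι → ℝ[X]} (hP : ∀ i, NonnegCoeffs (P i)) :
    NonnegCoeffs (∏ i ∈ s, P i) := by
  classical
  induction s using Finset.induction_on with
  | empty => simpa using one
  | insert i s hi ih =>
    rw [Finset.prod_insert hi]
    exact (hP i).mul ih

theorem eval_nonneg {P : ℝ[X]} (hP : NonnegCoeffs P) {r : ℝ} (hr : 0 ≤ r) : 0 ≤ P.eval r := by
  rw [eval_eq_sum, Polynomial.sum]
  exact Finset.sum_nonneg fun n _ => mul_nonneg (hP n) (pow_nonneg hr n)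

theorem comp {P Q : ℝ[X]} (hP : NonnegCoeffs P) (hQ : NonnegCoeffs Q) :
    NonnegCoeffs (P.comp Q) := fun n => by
  rw [Polynomial.comp, eval₂_eq_sum, Polynomial.sum, finsetSum_coeff]
  exact Finset.sum_nonneg fun i _ => ((C (hP i)).mul (hQ.pow i)) n

end NonnegCoeffs

namespace GraphProduct

/-! ### The relative centroid property. -/

section Centroid

variable {V : Type*} {Γ : SimpleGraph V} {G : V → Type*} [∀ v, Group (G v)]

/-- Additivity for three factors forces additivity at both cuts. -/
theorem mem_prefixes {a b c : GraphProduct Γ G} {r : ℝ}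
    (h : syllableLength Γ a + syllableLength Γ b + syllableLength Γ c ≤
      syllableLength Γ (a * b * c))
    (hr : (syllableLength Γ a + syllableLength Γ b : ℝ) ≤ r) :
    a ∈ prefixes Γ G (a * b * c) r ∧ a * b ∈ prefixes Γ G (a * b * c) r := by
  have h₁ := syllableLength_mul_le a b
  have h₂ := syllableLength_mul_le b c
  have h₃ : (syllableLength Γ (a * b) : ℝ) ≤ syllableLength Γ a + syllableLength Γ b := by
    exact_mod_cast h₁
  have h₄ : (0 : ℝ) ≤ syllableLength Γ b := Nat.cast_nonneg _
  refine ⟨⟨?_, by linarith⟩, ?_, by linarith⟩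
  · rw [mul_assoc, inv_mul_cancel_left, ← mul_assoc]
    omega
  · rw [inv_mul_cancel_left]
    omega

theorem length_middle_le (Lv : ∀ v, GroupSeminorm (G v)) {a b c : GraphProduct Γ G}
    (h : syllableLength Γ a + syllableLength Γ b + syllableLength Γ c ≤
      syllableLength Γ (a * b * c)) : length Γ Lv b ≤ length Γ Lv (a * b * c) := by
  have h₁ := syllableLength_mul_le a b
  have h₂ := syllableLength_mul_le (a * b) c
  rw [length_mul_of_add_le Lv (g := a * b) (by omega), length_mul_of_add_le Lv (by omega)]
  have h₃ := apply_nonneg (length Γ Lv) a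
  have h₄ := apply_nonneg (length Γ Lv) c
  linarith

namespace IsCliqueFactorization

variable {g k g₁ s₁ w s₂ h₁ : GraphProduct Γ G} {C : Finset V}

theorem eq_k (H : IsCliqueFactorization Γ g k C g₁ s₁ w s₂ h₁) : k = g₁ * (s₁ * s₂) * h₁ := by
  have : k = g * (g⁻¹ * k) := by simp
  rw [this, H.eq_h]
  conv_lhs => rw [H.eq_g]
  simp only [mul_assoc, mul_inv_cancel_left]

theorem add_card_le (H : IsCliqueFactorization Γ g k C g₁ s₁ w s₂ h₁) {r : ℝ}
    (hr : (syllableLength Γ g : ℝ) ≤ r) :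
    (syllableLength Γ g₁ + C.card : ℝ) ≤ r ∧ (syllableLength Γ w + C.card : ℝ) ≤ r := by
  have h := H.length_g
  rw [H.length_s₁] at h
  constructor
  · have : (syllableLength Γ g₁ + C.card : ℝ) ≤ syllableLength Γ g := by norm_cast; omega
    linarith
  · have : (syllableLength Γ w + C.card : ℝ) ≤ syllableLength Γ g := by norm_cast; omega
    linarith

theorem mem_prefixes_g (H : IsCliqueFactorization Γ g k C g₁ s₁ w s₂ h₁) {r : ℝ}
    (hr : (syllableLength Γ g : ℝ) ≤ r) :
    g₁ ∈ prefixes Γ G g r ∧ g₁ * s₁ ∈ prefixes Γ G g r := by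
  have h := H.length_g
  have h' := (H.add_card_le hr).1
  rw [← H.length_s₁] at h'
  rw [H.eq_g] at h ⊢
  exact mem_prefixes h.ge h'

theorem mem_prefixes_k (H : IsCliqueFactorization Γ g k C g₁ s₁ w s₂ h₁) {r : ℝ}
    (hr : (syllableLength Γ g : ℝ) ≤ r) :
    g₁ ∈ prefixes Γ G k r ∧ g₁ * s₁ * s₂ ∈ prefixes Γ G k r := by
  have h := H.length_k
  have h' := (H.add_card_le hr).1
  rw [← H.length_s] at h'
  rw [H.eq_k] at h ⊢
  rw [mul_assoc g₁ s₁]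
  exact mem_prefixes h.ge h'

theorem mem_prefixes_h (H : IsCliqueFactorization Γ g k C g₁ s₁ w s₂ h₁) {r : ℝ}
    (hr : (syllableLength Γ g : ℝ) ≤ r) :
    w⁻¹ ∈ prefixes Γ G (g⁻¹ * k) r ∧ w⁻¹ * s₂ ∈ prefixes Γ G (g⁻¹ * k) r := by
  have h := H.length_h
  have h' := (H.add_card_le hr).2
  rw [← H.length_s₂, ← syllableLength_inv] at h'
  rw [H.eq_h] at h ⊢
  exact mem_prefixes h.ge h'

end IsCliqueFactorization

variable (Γ G) in
theorem exists_isCliqueCentroidMap : ∃ rc, IsCliqueCentroidMap (G := G) Γ rc := by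
  choose C t₁ t₂ g₁ w h₁ _ _ _ H using exists_isCliqueFactorization (Γ := Γ) (G := G)
  exact ⟨_, fun g k => ⟨C g k, g₁ g k, _, w g k, _, h₁ g k, H g k, rfl⟩⟩

open Polynomial in
theorem IsCliqueCentroidMap.isSubgroupCentroidMap [Finite V] (Lv : ∀ v, GroupSeminorm (G v))
    {rc : GraphProduct Γ G → GraphProduct Γ G →
      GraphProduct Γ G × GraphProduct Γ G × GraphProduct Γ G}
    (hrc : IsCliqueCentroidMap Γ rc) :
    IsSubgroupCentroidMap (length Γ Lv)
      (fun C : {C : Finset V // Γ.IsClique (C : Set V)} =>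
        (vertexSubgroup Γ C.1 : Subgroup (GraphProduct Γ G))) rc := by
  have hL (g : GraphProduct Γ G) := syllableLength_le_length Lv g
  have hL₀ (g : GraphProduct Γ G) := apply_nonneg (length Γ Lv) g
  -- The power counts pairs of prefixes for the first three conditions; the summand `X` bounds the
  -- distances in the fourth.
  have heval (r : ℝ) : ((X + 1) ^ (2 * Nat.card V) + X : ℝ[X]).eval r =
      (r + 1) ^ Nat.card V * (r + 1) ^ Nat.card V + r := by
    simp [two_mul, pow_add]
  have hcount (r : ℝ) (hr : 0 ≤ r) : (r + 1) ^ Nat.card V * (r + 1) ^ Nat.card V ≤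
      ((X + 1) ^ (2 * Nat.card V) + X : ℝ[X]).eval r := by
    rw [heval]
    linarith
  have hself (r : ℝ) (hr : 0 ≤ r) : r ≤ ((X + 1) ^ (2 * Nat.card V) + X : ℝ[X]).eval r := by
    rw [heval]
    have : 0 ≤ (r + 1) ^ Nat.card V * (r + 1) ^ Nat.card V := by positivity
    linarith
  refine ⟨fun g k => ?_, (X + 1) ^ (2 * Nat.card V) + X,
    ((NonnegCoeffs.X.add .one).pow _).add .X, fun k r hr => ?_, fun g => ?_, fun h r hr => ?_,
    fun g k α β γ h => ?_⟩
  · obtain ⟨C, g₁, s₁, w, s₂, h₁, H, hrc⟩ := hrc g k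
    exact ⟨⟨C, H.isClique⟩, g₁, 1, one_mem _, s₁, H.mem₁, s₁ * s₂, mul_mem H.mem₁ H.mem₂, by
      rw [hrc, mul_one, mul_assoc]⟩
  · refine CountLE.of_subset_prod (countLE_prefixes k hr) (countLE_prefixes k hr) ?_ (hcount r hr)
    rintro ⟨α, γ⟩ ⟨g, β, hg, h⟩
    obtain ⟨C, g₁, s₁, w, s₂, h₁, H, hrc⟩ := hrc g k
    simp only [hrc, Prod.mk.injEq] at h
    obtain ⟨rfl, rfl, rfl⟩ := h
    exact H.mem_prefixes_k ((hL g).trans hg)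
  · refine CountLE.of_subset_prod (countLE_prefixes g (hL₀ g)) (countLE_prefixes g (hL₀ g)) ?_
      (hcount _ (hL₀ g))
    rintro ⟨α, β⟩ ⟨k, γ, h⟩
    obtain ⟨C, g₁, s₁, w, s₂, h₁, H, hrc⟩ := hrc g k
    simp only [hrc, Prod.mk.injEq] at h
    obtain ⟨rfl, rfl, rfl⟩ := h
    exact H.mem_prefixes_g (hL g)
  · refine CountLE.of_subset_prod (countLE_prefixes h hr) (countLE_prefixes h hr) ?_ (hcount r hr)
    rintro _ ⟨g, α, β, γ, hg, h', rfl⟩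
    obtain ⟨C, g₁, s₁, w, s₂, h₁, H, hrc⟩ := hrc g (g * h)
    simp only [hrc, Prod.mk.injEq] at h'
    obtain ⟨rfl, rfl, rfl⟩ := h'
    have h₂ := H.mem_prefixes_h ((hL g).trans hg)
    rw [inv_mul_cancel_left] at h₂
    -- Seen from `g`, the points `β` and `γ` are prefixes of `h`, whatever `g` is.
    have h₃ : g⁻¹ • (g₁ * s₁) = w⁻¹ := by
      rw [smul_eq_mul, inv_mul_eq_iff_eq_mul, eq_mul_inv_iff_mul_eq, ← H.eq_g]
    have h₄ : g⁻¹ • (g₁ * s₁ * s₂) = w⁻¹ * s₂ := by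
      rw [← h₃]
      simp only [smul_eq_mul, mul_assoc]
    rw [h₃, h₄]
    exact h₂
  · obtain ⟨C, g₁, s₁, w, s₂, h₁, H, hrc⟩ := hrc g k
    simp only [hrc, Prod.mk.injEq] at h
    obtain ⟨rfl, rfl, rfl⟩ := h
    have e₁ := H.length_g.ge
    have e₂ := H.length_k.ge
    have e₃ := H.length_h.ge
    have f₁ := hself _ (hL₀ g)
    have f₂ := hself _ (hL₀ k)
    have f₃ := hself _ (hL₀ (g⁻¹ * k))
    refine ⟨le_trans ?_ f₁, le_trans ?_ f₂, le_trans ?_ f₃⟩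
    · change length Γ Lv (g₁⁻¹ * (g₁ * s₁)) ≤ _
      rw [inv_mul_cancel_left]
      rw [H.eq_g] at e₁ ⊢
      exact length_middle_le Lv e₁
    · change length Γ Lv (g₁⁻¹ * (g₁ * s₁ * s₂)) ≤ _
      rw [mul_assoc g₁, inv_mul_cancel_left]
      rw [H.eq_k] at e₂ ⊢
      exact length_middle_le Lv e₂
    · change length Γ Lv ((g₁ * s₁)⁻¹ * (g₁ * s₁ * s₂)) ≤ _
      rw [inv_mul_cancel_left]
      rw [H.eq_h] at e₃ ⊢
      exact length_middle_le Lv e₃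

theorem hasSubgroupCentroidProperty [Finite V] (Lv : ∀ v, GroupSeminorm (G v)) :
    HasSubgroupCentroidProperty (length Γ Lv)
      (fun C : {C : Finset V // Γ.IsClique (C : Set V)} =>
        (vertexSubgroup Γ C.1 : Subgroup (GraphProduct Γ G))) := by
  let _ : PseudoMetricSpace (GraphProduct Γ G) := lengthDist (length Γ Lv)
  refine ⟨⟨fun g => ?_⟩, ⟨1, fun x => ?_⟩, ?_, ?_⟩
  · refine Isometry.of_dist_eq fun x y => ?_
    change length Γ Lv ((g * x)⁻¹ * (g * y)) = length Γ Lv (x⁻¹ * y)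
    congr 1
    group
  · have : MulAction.stabilizer (GraphProduct Γ G) x = ⊥ := by
      ext g
      simp
    rw [this]
    exact ⟨inferInstance, by simp⟩
  · rintro C g x y z ⟨a, h₁, hh₁, h₂, hh₂, h₃, hh₃, h⟩
    simp only [Prod.mk.injEq] at h
    obtain ⟨rfl, rfl, rfl⟩ := h
    exact ⟨g * a, h₁, hh₁, h₂, hh₂, h₃, hh₃, by simp [mul_assoc]⟩
  · obtain ⟨rc, hrc⟩ := exists_isCliqueCentroidMap Γ G
    exact ⟨rc, hrc.isSubgroupCentroidMap Lv⟩

end Centroid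

end GraphProduct

open scoped ENNReal

/-! ### Square sums with values in `ℝ≥0∞`, where no summability is needed. -/

section Tsum

variable {α β : Type*}

/-- The `l²`-norm of a function with values in `ℝ≥0∞`. -/
noncomputable def l2norm (f : α → ℝ≥0∞) : ℝ≥0∞ := (∑' a, f a ^ 2) ^ (1 / 2 : ℝ)

theorem l2norm_sq (f : α → ℝ≥0∞) : l2norm f ^ 2 = ∑' a, f a ^ 2 := by
  rw [l2norm, ← ENNReal.rpow_two, ← ENNReal.rpow_mul]
  norm_num

theorem tsum_mul_le_l2norm (f g : α → ℝ≥0∞) : ∑' a, f a * g a ≤ l2norm f * l2norm g := by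
  rw [ENNReal.tsum_eq_iSup_sum]
  refine iSup_le fun s => ?_
  have h := ENNReal.inner_le_Lp_mul_Lq s f g Real.HolderConjugate.two_two
  simp only [ENNReal.rpow_two] at h
  exact h.trans (mul_le_mul' (ENNReal.rpow_le_rpow (ENNReal.sum_le_tsum s) (by norm_num))
    (ENNReal.rpow_le_rpow (ENNReal.sum_le_tsum s) (by norm_num)))

theorem sq_tsum (f : α → ℝ≥0∞) : (∑' a, f a) ^ 2 = ∑' a, ∑' b, f a * f b := by
  rw [sq, ← ENNReal.tsum_mul_right]
  simp_rw [ENNReal.tsum_mul_left]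

/-- Minkowski's inequality. -/
theorem tsum_sq_tsum_le (F : β → α → ℝ≥0∞) :
    ∑' a, (∑' b, F b a) ^ 2 ≤ (∑' b, l2norm (F b)) ^ 2 := by
  simp_rw [sq_tsum]
  rw [ENNReal.tsum_comm]
  refine ENNReal.tsum_le_tsum fun b => ?_
  rw [ENNReal.tsum_comm]
  exact ENNReal.tsum_le_tsum fun b' => tsum_mul_le_l2norm _ _

theorem tsum_indicator_one (S : Set α) :
    ∑' a, S.indicator (1 : α → ℝ≥0∞) a = S.encard := by
  rw [← ENNReal.tsum_set_one]
  exact (tsum_subtype S 1).symm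

/-- Cauchy–Schwarz against the indicator of `S`. -/
theorem sq_tsum_le_encard (S : Set α) (f : α → ℝ≥0∞) (hf : ∀ a ∉ S, f a = 0) :
    (∑' a, f a) ^ 2 ≤ S.encard * ∑' a, f a ^ 2 := by
  classical
  have h₁ : ∑' a, f a = ∑' a, S.indicator 1 a * f a := tsum_congr fun a => by
    by_cases ha : a ∈ S <;> simp [ha, hf]
  have h₂ : ∑' a, S.indicator (1 : α → ℝ≥0∞) a ^ 2 = S.encard := by
    rw [← tsum_indicator_one]
    exact tsum_congr fun a => by by_cases ha : a ∈ S <;> simp [ha]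
  rw [h₁, ← h₂, ← l2norm_sq, ← l2norm_sq, ← mul_pow]
  gcongr
  exact tsum_mul_le_l2norm _ _

theorem sq_finset_sum_le (s : Finset α) (f : α → ℝ≥0∞) :
    (∑ a ∈ s, f a) ^ 2 ≤ s.card * ∑ a ∈ s, f a ^ 2 := by
  have h := sq_tsum_le_encard (Set.univ : Set s) (fun a => f a) (by simp)
  rw [tsum_fintype, tsum_fintype, Finset.sum_coe_sort s f,
    Finset.sum_coe_sort s fun a => f a ^ 2] at h
  simpa using h

/-- Each `F b` is counted once for every point of `M` above `b`. -/
theorem tsum_fiber_le {p : α → β} {M : Set α} {N : ℝ≥0∞}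
    (hN : ∀ b, ((M ∩ p ⁻¹' {b}).encard : ℝ≥0∞) ≤ N) (F : β → ℝ≥0∞) :
    ∑' a, M.indicator (fun a => F (p a)) a ≤ N * ∑' b, F b := by
  classical
  calc ∑' a, M.indicator (fun a => F (p a)) a
      = ∑' a, ∑' b, (M ∩ p ⁻¹' {b}).indicator 1 a * F b := tsum_congr fun a => by
        rw [tsum_eq_single (p a) fun b hb => by simp [hb.symm]]
        by_cases ha : a ∈ M <;> simp [ha]
    _ = ∑' b, ((M ∩ p ⁻¹' {b}).encard : ℝ≥0∞) * F b := by
        rw [ENNReal.tsum_comm]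
        refine tsum_congr fun b => ?_
        rw [ENNReal.tsum_mul_right, tsum_indicator_one]
    _ ≤ ∑' b, N * F b := ENNReal.tsum_le_tsum fun b => mul_le_mul_left (hN b) _
    _ = N * ∑' b, F b := ENNReal.tsum_mul_left

end Tsum

/-! ### Convolution bounds for subgroups and direct products. -/

/-- Convolution by functions supported on `S` is bounded by `c` on `l²`, up to squares. -/
def ConvBound {K : Type*} [Group K] (S : Set K) (c : ℝ≥0∞) : Prop :=
  ∀ f h : K → ℝ≥0∞, (∀ g, f g ≠ 0 → g ∈ S) →
    ∑' k, (∑' g, f g * h (g⁻¹ * k)) ^ 2 ≤ c * (∑' g, f g ^ 2) * ∑' g, h g ^ 2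

namespace ConvBound

theorem mono {K : Type*} [Group K] {S T : Set K} {c d : ℝ≥0∞} (hS : ConvBound S c) (hTS : T ⊆ S)
    (hcd : c ≤ d) : ConvBound T d := fun f h hf =>
  (hS f h fun g hg => hTS (hf g hg)).trans (by gcongr)

/-- Extension by zero along `j` preserves norms, and the convolution of the extensions restricts to
the original one on the image. -/
theorem comap {K K' : Type*} [Group K] [Group K'] {S : Set K'} {c : ℝ≥0∞} (hS : ConvBound S c)
    (j : K →* K') (hj : Function.Injective j) : ConvBound (j ⁻¹' S) c := by
  intro f h hf
  have hext (f : K → ℝ≥0∞) (g : K) : Function.extend j f 0 (j g) = f g := hj.extend_apply f 0 g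
  have hsupp (f : K → ℝ≥0∞) {k : K'} (hk : Function.extend j f 0 k ≠ 0) : k ∈ Set.range j := by
    by_contra hn
    exact hk (by rw [Function.extend_apply' _ _ _ hn, Pi.zero_apply])
  have hnorm (f : K → ℝ≥0∞) : ∑' k, Function.extend j f 0 k ^ 2 = ∑' g, f g ^ 2 := by
    rw [← hj.tsum_eq fun k hk => hsupp f (pow_ne_zero_iff two_ne_zero |>.1 hk)]
    simp_rw [hext]
  have key := hS (Function.extend j f 0) (Function.extend j h 0) fun k hk => by
    obtain ⟨g, rfl⟩ := hsupp f hk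
    rw [hext] at hk
    exact hf g hk
  rw [hnorm, hnorm] at key
  refine le_trans ?_ key
  refine le_trans (le_of_eq (tsum_congr fun k => ?_)) (ENNReal.tsum_comp_le_tsum_of_injective hj _)
  rw [← hj.tsum_eq fun k hk => hsupp f (left_ne_zero_of_mul hk)]
  simp_rw [hext, ← map_inv, ← map_mul, hext]

/-- Slice along `B`. Minkowski and the bound on `A` dominate the norm of each slice of the
convolution by `√c` times a convolution on `B` of the slice norms, to which the bound on `B`
applies. -/
theorem prod {A B : Type*} [Group A] [Group B] {S : Set A} {T : Set B} {c d : ℝ≥0∞}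
    (hS : ConvBound S c) (hT : ConvBound T d) : ConvBound (S ×ˢ T) (c * d) := by
  intro f h hf
  let F (b : B) : ℝ≥0∞ := l2norm fun a => f (a, b)
  let H (b : B) : ℝ≥0∞ := l2norm fun a => h (a, b)
  let s : ℝ≥0∞ := c ^ (1 / 2 : ℝ)
  have hs : s ^ 2 = c := by
    rw [← ENNReal.rpow_two, ← ENNReal.rpow_mul]
    norm_num
  have h₁ (b b' : B) :
      l2norm (fun a => ∑' a', f (a', b') * h (a'⁻¹ * a, b'⁻¹ * b)) ≤ s * (F b' * H (b'⁻¹ * b)) := by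
    rw [← ENNReal.rpow_le_rpow_iff (z := 2) (by norm_num), ENNReal.rpow_two, ENNReal.rpow_two,
      l2norm_sq, mul_pow, mul_pow, hs, l2norm_sq, l2norm_sq, ← mul_assoc]
    exact hS _ (fun a => h (a, b'⁻¹ * b)) fun a ha => (hf _ ha).1
  have h₂ (b : B) : ∑' a, (∑' g : A × B, f g * h (g⁻¹ * (a, b))) ^ 2 ≤
      c * (∑' b', F b' * H (b'⁻¹ * b)) ^ 2 := by
    calc ∑' a, (∑' g : A × B, f g * h (g⁻¹ * (a, b))) ^ 2
        = ∑' a, (∑' b', ∑' a', f (a', b') * h (a'⁻¹ * a, b'⁻¹ * b)) ^ 2 :=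
          tsum_congr fun a => by
            rw [ENNReal.tsum_prod', ENNReal.tsum_comm]
            rfl
      _ ≤ (∑' b', l2norm fun a => ∑' a', f (a', b') * h (a'⁻¹ * a, b'⁻¹ * b)) ^ 2 :=
          tsum_sq_tsum_le _
      _ ≤ (∑' b', s * (F b' * H (b'⁻¹ * b))) ^ 2 := by
          gcongr with b'
          exact h₁ b b'
      _ = c * (∑' b', F b' * H (b'⁻¹ * b)) ^ 2 := by
          rw [ENNReal.tsum_mul_left, mul_pow, hs]
  have h₃ := hT F H fun b hb => by
    by_contra hn
    refine hb ?_
    have : (fun a => f (a, b)) = 0 := by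
      funext a
      by_contra hab
      exact hn (hf _ hab).2
    change l2norm (fun a => f (a, b)) = 0
    rw [this]
    simp [l2norm]
  have h₄ (f : A × B → ℝ≥0∞) : ∑' b, (l2norm fun a => f (a, b)) ^ 2 = ∑' g, f g ^ 2 := by
    simp_rw [l2norm_sq]
    rw [ENNReal.tsum_comm, ENNReal.tsum_prod']
  calc ∑' k, (∑' g, f g * h (g⁻¹ * k)) ^ 2
      = ∑' b, ∑' a, (∑' g : A × B, f g * h (g⁻¹ * (a, b))) ^ 2 := by
        rw [ENNReal.tsum_prod', ENNReal.tsum_comm]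
    _ ≤ ∑' b, c * (∑' b', F b' * H (b'⁻¹ * b)) ^ 2 := ENNReal.tsum_le_tsum h₂
    _ = c * ∑' b, (∑' b', F b' * H (b'⁻¹ * b)) ^ 2 := ENNReal.tsum_mul_left
    _ ≤ c * (d * (∑' b, F b ^ 2) * ∑' b, H b ^ 2) := by gcongr
    _ = c * d * (∑' g, f g ^ 2) * ∑' g, h g ^ 2 := by
        simp only [F, H, h₄]
        ring

theorem pi {ι : Type*} [Fintype ι] {K : ι → Type*} [∀ i, Group (K i)] {S : ∀ i, Set (K i)}
    {c : ι → ℝ≥0∞} (hS : ∀ i, ConvBound (S i) (c i)) :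
    ConvBound (Set.pi Set.univ S) (∏ i, c i) := by
  revert K
  refine Fintype.induction_empty_option
    (P := fun ι _ => ∀ {K : ι → Type _} [∀ i, Group (K i)] {S : ∀ i, Set (K i)} {c : ι → ℝ≥0∞},
      (∀ i, ConvBound (S i) (c i)) → ConvBound (Set.pi Set.univ S) (∏ i, c i)) ?_ ?_ ?_ ι
  · intro α β _ e ih K _ S c hS
    let _ := Fintype.ofEquiv β e.symm
    let j : (∀ b, K b) →* ∀ a, K (e a) := MonoidHom.pi fun a => Pi.evalMonoidHom K (e a)
    have hj : Function.Injective j := fun x y hxy => by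
      funext b
      obtain ⟨a, rfl⟩ := e.surjective b
      exact congrFun hxy a
    refine ((ih fun a => hS (e a)).comap j hj).mono (fun x hx a _ => hx (e a) trivial) (le_of_eq ?_)
    exact Fintype.prod_equiv e _ _ fun _ => rfl
  · intro K _ S c _ f h _
    have h₁ (F : (∀ i, K i) → ℝ≥0∞) : ∑' g, F g = F 1 :=
      tsum_eq_single 1 fun g hg => absurd (Subsingleton.elim g 1) hg
    simp only [h₁]
    simp [mul_pow]
  · intro α _ ih K _ S c hS
    let j : (∀ o, K o) →* K none × ∀ a, K (some a) :=
      (Pi.evalMonoidHom K none).prod (MonoidHom.pi fun a => Pi.evalMonoidHom K (some a))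
    have hj : Function.Injective j := fun x y hxy => by
      funext o
      rcases o with _ | a
      · exact congrArg Prod.fst hxy
      · exact congrFun (congrArg Prod.snd hxy) a
    refine (((hS none).prod (ih fun a => hS (some a))).comap j hj).mono
      (fun x hx => ⟨hx none trivial, fun a _ => hx (some a) trivial⟩) (le_of_eq ?_)
    rw [Fintype.prod_option]

end ConvBound

/-! ### Comparison with the real-valued definition -/

section Real

variable {K : Type*}

theorem ofReal_finsum {u : K → ℝ} (hu : ∀ a, 0 ≤ u a) (hf : u.support.Finite) :
    ENNReal.ofReal (∑ᶠ a, u a) = ∑' a, ENNReal.ofReal (u a) := by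
  rw [finsum_eq_sum_of_support_toFinset_subset u hf subset_rfl,
    ENNReal.ofReal_sum_of_nonneg fun a _ => hu a, tsum_eq_sum]
  intro a ha
  have : u a = 0 := by simpa using ha
  simp [this]

theorem ofReal_sqNorm {φ : K → ℝ} (hφ : ∀ a, 0 ≤ φ a) (hf : φ.support.Finite) :
    ENNReal.ofReal (sqNorm φ) = ∑' a, ENNReal.ofReal (φ a) ^ 2 := by
  rw [sqNorm, ofReal_finsum (fun a => sq_nonneg _) (hf.subset fun a ha => ?_)]
  · exact tsum_congr fun a => ENNReal.ofReal_pow (hφ a) 2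
  · exact (pow_ne_zero_iff two_ne_zero).1 ha

theorem sqNorm_nonneg (φ : K → ℝ) : 0 ≤ sqNorm φ :=
  finsum_nonneg fun _ => sq_nonneg _

variable [Group K]

theorem ofReal_groupConv {φ ψ : K → ℝ} (hφ : ∀ a, 0 ≤ φ a) (hψ : ∀ a, 0 ≤ ψ a)
    (hf : φ.support.Finite) (k : K) :
    ENNReal.ofReal (groupConv φ ψ k) =
      ∑' g, ENNReal.ofReal (φ g) * ENNReal.ofReal (ψ (g⁻¹ * k)) := by
  rw [groupConv, ofReal_finsum (fun a => mul_nonneg (hφ _) (hψ _)) (hf.subset fun a ha => ?_)]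
  · exact tsum_congr fun a => ENNReal.ofReal_mul (hφ a)
  · exact left_ne_zero_of_mul ha

theorem ofReal_sqNorm_groupConv {φ ψ : K → ℝ} (hφ : ∀ a, 0 ≤ φ a) (hψ : ∀ a, 0 ≤ ψ a)
    (hf : φ.support.Finite) (hf' : ψ.support.Finite) :
    ENNReal.ofReal (sqNorm (groupConv φ ψ)) =
      ∑' k, (∑' g, ENNReal.ofReal (φ g) * ENNReal.ofReal (ψ (g⁻¹ * k))) ^ 2 := by
  rw [ofReal_sqNorm (φ := groupConv φ ψ) fun k => finsum_nonneg fun g =>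
    mul_nonneg (hφ _) (hψ _)]
  · simp_rw [ofReal_groupConv hφ hψ hf]
  · refine (hf.image2 (· * ·) hf').subset fun k hk => ?_
    obtain ⟨g, hg⟩ : ∃ g, φ g * ψ (g⁻¹ * k) ≠ 0 := by
      by_contra! hn
      exact hk (by simp [groupConv, hn])
    exact ⟨g, left_ne_zero_of_mul hg, g⁻¹ * k, right_ne_zero_of_mul hg, mul_inv_cancel_left g k⟩

/-- Truncate to finite sets and pass to the limit. Positivity of `c` makes the right-hand side
infinite when one norm is infinite and the other nonzero. -/
theorem convBound_of_real {S : Set K} {c : ℝ} (hc : 0 < c)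
    (hS : ∀ φ ψ : K → ℝ, (∀ g, 0 ≤ φ g) → (∀ g, 0 ≤ ψ g) → φ.support.Finite → ψ.support.Finite →
      (∀ g, φ g ≠ 0 → g ∈ S) → sqNorm (groupConv φ ψ) ≤ c * sqNorm φ * sqNorm ψ) :
    ConvBound S (ENNReal.ofReal c) := by
  classical
  intro f h hf
  have hc' : ENNReal.ofReal c ≠ 0 := by simpa using hc
  by_cases hf₀ : ∑' g, f g ^ 2 = 0
  · simp [fun g => (pow_eq_zero_iff two_ne_zero).1 (ENNReal.tsum_eq_zero.1 hf₀ g)]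
  by_cases hh₀ : ∑' g, h g ^ 2 = 0
  · simp [fun g => (pow_eq_zero_iff two_ne_zero).1 (ENNReal.tsum_eq_zero.1 hh₀ g)]
  by_cases hf₁ : ∑' g, f g ^ 2 = ∞
  · rw [hf₁, ENNReal.mul_top hc', ENNReal.top_mul hh₀]
    exact le_top
  by_cases hh₁ : ∑' g, h g ^ 2 = ∞
  · rw [hh₁, ENNReal.mul_top (mul_ne_zero hc' hf₀)]
    exact le_top
  have hfin {f : K → ℝ≥0∞} (h : ∑' g, f g ^ 2 ≠ ∞) (g : K) : f g ≠ ∞ := fun hg =>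
    ENNReal.ne_top_of_tsum_ne_top h g (by simp [hg])
  rw [ENNReal.tsum_eq_iSup_sum]
  refine iSup_le fun T => ?_
  refine le_of_tendsto' (x := Filter.atTop)
    (f := fun A : Finset K => ∑ k ∈ T, (∑ g ∈ A, f g * h (g⁻¹ * k)) ^ 2) ?_ fun A => ?_
  · refine tendsto_finsetSum _ fun k _ => ?_
    exact ((ENNReal.continuous_pow 2).tendsto _).comp ENNReal.summable.hasSum
  -- `B` contains every argument at which `h` is evaluated in the finite sums, so truncating `h` to
  -- `B` does not change them.
  let B : Finset K := Finset.image₂ (fun g k => g⁻¹ * k) A T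
  let φ (g : K) : ℝ := if g ∈ A then (f g).toReal else 0
  let ψ (g : K) : ℝ := if g ∈ B then (h g).toReal else 0
  have hφ (g : K) : 0 ≤ φ g := by
    simp only [φ]
    split_ifs <;> simp
  have hψ (g : K) : 0 ≤ ψ g := by
    simp only [ψ]
    split_ifs <;> simp
  have hφA : φ.support ⊆ A := fun g hg => by
    by_contra hn
    exact hg (if_neg hn)
  have hψB : ψ.support ⊆ B := fun g hg => by
    by_contra hn
    exact hg (if_neg hn)
  have hφf (g : K) : ENNReal.ofReal (φ g) ≤ f g := by
    simp only [φ]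
    split_ifs <;> simp [ENNReal.ofReal_toReal (hfin hf₁ g)]
  have hψh (g : K) : ENNReal.ofReal (ψ g) ≤ h g := by
    simp only [ψ]
    split_ifs <;> simp [ENNReal.ofReal_toReal (hfin hh₁ g)]
  have hφe {g : K} (hg : g ∈ A) : ENNReal.ofReal (φ g) = f g := by
    simp [φ, hg, ENNReal.ofReal_toReal (hfin hf₁ g)]
  have hψe {g : K} (hg : g ∈ B) : ENNReal.ofReal (ψ g) = h g := by
    simp [ψ, hg, ENNReal.ofReal_toReal (hfin hh₁ g)]
  have hφfin := A.finite_toSet.subset hφA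
  have hψfin := B.finite_toSet.subset hψB
  have key := ENNReal.ofReal_le_ofReal (hS φ ψ hφ hψ hφfin hψfin fun g hg => hf g fun h₀ => by
    have := hφf g
    rw [h₀, nonpos_iff_eq_zero, ENNReal.ofReal_eq_zero] at this
    exact hg (this.antisymm (hφ g)))
  rw [ENNReal.ofReal_mul (mul_nonneg hc.le (sqNorm_nonneg φ)), ENNReal.ofReal_mul hc.le,
    ofReal_sqNorm_groupConv hφ hψ hφfin hψfin, ofReal_sqNorm hφ hφfin,
    ofReal_sqNorm hψ hψfin] at key
  calc ∑ k ∈ T, (∑ g ∈ A, f g * h (g⁻¹ * k)) ^ 2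
      = ∑ k ∈ T, (∑ g ∈ A, ENNReal.ofReal (φ g) * ENNReal.ofReal (ψ (g⁻¹ * k))) ^ 2 := by
        refine Finset.sum_congr rfl fun k hk => ?_
        congr 1
        refine Finset.sum_congr rfl fun g hg => ?_
        rw [hφe hg, hψe (Finset.mem_image₂_of_mem hg hk)]
    _ ≤ ∑ k ∈ T, (∑' g, ENNReal.ofReal (φ g) * ENNReal.ofReal (ψ (g⁻¹ * k))) ^ 2 := by
        gcongr with k
        exact ENNReal.sum_le_tsum A
    _ ≤ _ := ENNReal.sum_le_tsum T
    _ ≤ _ := key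
    _ ≤ _ := by
        gcongr with g g
        · exact hφf g
        · exact hψh g

theorem ConvBound.real {S : Set K} {c : ℝ} (hc : 0 ≤ c) (hS : ConvBound S (ENNReal.ofReal c))
    {φ ψ : K → ℝ} (hφ : ∀ g, 0 ≤ φ g) (hψ : ∀ g, 0 ≤ ψ g) (hf : φ.support.Finite)
    (hf' : ψ.support.Finite) (hφS : ∀ g, φ g ≠ 0 → g ∈ S) :
    sqNorm (groupConv φ ψ) ≤ c * sqNorm φ * sqNorm ψ := by
  have h₀ := mul_nonneg hc (sqNorm_nonneg φ)
  rw [← ENNReal.ofReal_le_ofReal_iff (mul_nonneg h₀ (sqNorm_nonneg ψ)), ENNReal.ofReal_mul h₀,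
    ENNReal.ofReal_mul hc, ofReal_sqNorm_groupConv hφ hψ hf hf', ofReal_sqNorm hφ hf,
    ofReal_sqNorm hψ hf']
  refine hS _ _ fun g hg => hφS g fun h => hg ?_
  rw [h, ENNReal.ofReal_zero]

theorem hasRD_iff_convBound (L : GroupSeminorm K) :
    HasRD L ↔ ∃ P : Polynomial ℝ, NonnegCoeffs P ∧
      ∀ r : ℝ, 0 < r → ConvBound {g | L g ≤ r} (ENNReal.ofReal (P.eval r)) := by
  constructor
  · rintro ⟨P, hP, h⟩
    -- The added `1` makes the constant strictly positive.
    refine ⟨P + 1, hP.add .one, fun r hr => ?_⟩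
    have hPr := hP.eval_nonneg hr.le
    rw [Polynomial.eval_add, Polynomial.eval_one]
    refine convBound_of_real (by linarith) fun φ ψ hφ hψ hf hf' hS =>
      (h r hr φ ψ hφ hψ hf hf' hS).trans ?_
    have h₁ := sqNorm_nonneg φ
    have h₂ := sqNorm_nonneg ψ
    gcongr
    linarith
  · rintro ⟨P, hP, h⟩
    exact ⟨P, hP, fun r hr φ ψ hφ hψ hf hf' hS =>
      (h r hr).real (hP.eval_nonneg hr.le) hφ hψ hf hf' hS⟩

end Real


theorem CountLE.encard_le {α : Type*} {S : Set α} {b : ℝ} (h : CountLE S b) :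
    (S.encard : ℝ≥0∞) ≤ ENNReal.ofReal b := by
  rw [← h.1.cast_ncard_eq, ENat.toENNReal_coe, ← ENNReal.ofReal_natCast]
  exact ENNReal.ofReal_le_ofReal h.2

namespace GraphProduct

/-! ### Rapid decay of graph products. -/

section RapidDecay

variable {V : Type*} (Γ : SimpleGraph V) {G : V → Type*} [∀ v, Group (G v)]

/-- The product of a triple, the middle of which is a family of elements of the vertex groups of
`C`. -/
noncomputable def tripleProd (C : Finset V)
    (x : GraphProduct Γ G × (∀ v, G v) × GraphProduct Γ G) : GraphProduct Γ G :=
  x.1 * familyProd Γ C.toList x.2.1 * x.2.2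

variable (G) in
/-- The triples for which the syllable length of `tripleProd` is additive, with a first part of
length at most `r`. -/
def admissible (C : Finset V) (r : ℝ) : Set (GraphProduct Γ G × (∀ v, G v) × GraphProduct Γ G) :=
  {x | Γ.IsClique (C : Set V) ∧ x.2.1 ∈ fullSupport C ∧
    syllableLength Γ x.1 + C.card + syllableLength Γ x.2.2 ≤ syllableLength Γ (tripleProd Γ C x) ∧
    (syllableLength Γ x.1 + C.card : ℝ) ≤ r}

variable {Γ}

/-- The first part and its product with the middle are prefixes of `g`; they determine the middle,
by `familyProd_injOn`, and hence the triple. -/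
theorem encard_admissible_le [Finite V] (C : Finset V) {r : ℝ} (hr : 0 ≤ r)
    (g : GraphProduct Γ G) :
    ((admissible Γ G C r ∩ tripleProd Γ C ⁻¹' {g}).encard : ℝ≥0∞) ≤
      ENNReal.ofReal ((r + 1) ^ Nat.card V * (r + 1) ^ Nat.card V) := by
  refine le_trans ?_ (CountLE.of_subset_prod (countLE_prefixes g hr) (countLE_prefixes g hr)
    subset_rfl le_rfl).encard_le
  gcongr
  refine Set.encard_le_encard_of_injOn
    (f := fun x => (x.1, x.1 * familyProd Γ C.toList x.2.1)) ?_ ?_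
  · rintro x ⟨⟨hC, ht, hlen, hr⟩, rfl⟩
    rw [← syllableLength_familyProd_toList hC ht] at hlen hr
    exact mem_prefixes hlen hr
  · rintro x ⟨⟨hC, ht, -⟩, hx⟩ y ⟨⟨-, ht', -⟩, hy⟩ hxy
    simp only [Prod.mk.injEq] at hxy
    obtain ⟨h₁, h₂⟩ := hxy
    rw [h₁, mul_right_inj] at h₂
    have h₃ := familyProd_injOn hC ht ht' h₂
    have h₄ : tripleProd Γ C x = tripleProd Γ C y := Eq.trans hx (Eq.symm hy)
    rw [tripleProd, tripleProd, h₁, h₃, mul_right_inj] at h₄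
    exact Prod.ext h₁ (Prod.ext h₃ h₄)

/-- The norms of the restrictions of `f` to the elements `a t w`, for fixed `a` and `t`. -/
noncomputable def leftNorm (f : GraphProduct Γ G → ℝ≥0∞) (r : ℝ) (C : Finset V)
    (a : GraphProduct Γ G) (t : ∀ v, G v) : ℝ≥0∞ :=
  l2norm fun w => (admissible Γ G C r).indicator (fun x => f (tripleProd Γ C x)) (a, t, w)

/-- The norms of the restrictions of `h` to the elements `w⁻¹ t b`, for fixed `t` and `b`. -/
noncomputable def rightNorm (h : GraphProduct Γ G → ℝ≥0∞) (r : ℝ) (C : Finset V)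
    (b : GraphProduct Γ G) (t : ∀ v, G v) : ℝ≥0∞ :=
  l2norm fun w => (admissible Γ G C r).indicator (fun x => h (tripleProd Γ C x)) (w⁻¹, t, b)

theorem tsum_leftNorm_le [Finite V] (f : GraphProduct Γ G → ℝ≥0∞) {r : ℝ} (hr : 0 ≤ r)
    (C : Finset V) : ∑' a, ∑' t, leftNorm f r C a t ^ 2 ≤
      ENNReal.ofReal ((r + 1) ^ Nat.card V * (r + 1) ^ Nat.card V) * ∑' g, f g ^ 2 := by
  refine le_trans (le_of_eq ?_) (tsum_fiber_le (encard_admissible_le C hr) fun g => f g ^ 2)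
  simp_rw [leftNorm, l2norm_sq]
  rw [ENNReal.tsum_prod']
  refine tsum_congr fun a => ?_
  rw [ENNReal.tsum_prod']
  refine tsum_congr fun t => tsum_congr fun w => ?_
  by_cases hx : (a, t, w) ∈ admissible Γ G C r <;> simp [hx]

theorem tsum_rightNorm_le [Finite V] (h : GraphProduct Γ G → ℝ≥0∞) {r : ℝ} (hr : 0 ≤ r)
    (C : Finset V) : ∑' b, ∑' t, rightNorm h r C b t ^ 2 ≤
      ENNReal.ofReal ((r + 1) ^ Nat.card V * (r + 1) ^ Nat.card V) * ∑' g, h g ^ 2 := by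
  refine le_trans (le_of_eq ?_) (tsum_fiber_le (encard_admissible_le C hr) fun g => h g ^ 2)
  simp_rw [rightNorm, l2norm_sq]
  rw [ENNReal.tsum_prod', ENNReal.tsum_comm]
  simp_rw [ENNReal.tsum_prod', ENNReal.tsum_comm (α := GraphProduct Γ G) (β := ∀ v, G v)]
  refine tsum_congr fun t => ?_
  -- The first part of the triple is `w⁻¹`, so the sum over `w` is reindexed by inversion.
  rw [ENNReal.tsum_comm, ← (Equiv.inv (GraphProduct Γ G)).tsum_eq]
  refine tsum_congr fun w => tsum_congr fun b => ?_
  by_cases hx : (w, t, b) ∈ admissible Γ G C r <;> simp [hx]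

theorem le_of_leftNorm_ne_zero (Lv : ∀ v, GroupSeminorm (G v)) {f : GraphProduct Γ G → ℝ≥0∞}
    {r : ℝ} (hf : ∀ g, f g ≠ 0 → length Γ Lv g ≤ r) {C : Finset V} {a : GraphProduct Γ G}
    {t : ∀ v, G v} (ht : leftNorm f r C a t ≠ 0) (v : V) : Lv v (t v) ≤ r := by
  obtain ⟨w, hw⟩ : ∃ w, (admissible Γ G C r).indicator (fun x => f (tripleProd Γ C x))
      (a, t, w) ≠ 0 := by
    by_contra! hn
    exact ht (by simp [leftNorm, l2norm, hn])
  have hx := Set.mem_of_indicator_ne_zero hw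
  rw [Set.indicator_of_mem hx] at hw
  obtain ⟨hC, ht, hlen, -⟩ := hx
  rw [← syllableLength_familyProd_toList hC ht] at hlen
  exact (length_le_of_family Lv hC ht v).trans ((length_middle_le Lv hlen).trans (hf _ hw))

/-- The value of a convolution is bounded by convolutions over the cliques. -/
theorem conv_le_sum_clique [Fintype V] (Lv : ∀ v, GroupSeminorm (G v))
    {f : GraphProduct Γ G → ℝ≥0∞} (h : GraphProduct Γ G → ℝ≥0∞) {r : ℝ}
    (hf : ∀ g, f g ≠ 0 → length Γ Lv g ≤ r) (k : GraphProduct Γ G) :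
    ∑' g, f g * h (g⁻¹ * k) ≤ ∑ C : Finset V, ∑' x,
      (admissible Γ G C r ∩ tripleProd Γ C ⁻¹' {k}).indicator (fun x =>
        ∑' t, leftNorm f r C x.1 t * rightNorm h r C x.2.2 (t⁻¹ * x.2.1)) x := by
  classical
  choose C t₁ t₂ g₁ w h₁ ht₁ ht₂ ht H using fun g => exists_isCliqueFactorization (Γ := Γ) g k
  let F (C : Finset V) := (admissible Γ G C r).indicator fun x => f (tripleProd Γ C x)
  let F' (C : Finset V) := (admissible Γ G C r).indicator fun x => h (tripleProd Γ C x)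
  -- For fixed `k`, the clique, the factorization of `k`, `t₁` and `w` determine `g`. So the sum
  -- over `g` embeds into the sum over all such data, admissible or not.
  let e (g : GraphProduct Γ G) : Finset V ×
      (GraphProduct Γ G × (∀ v, G v) × GraphProduct Γ G) × (∀ v, G v) × GraphProduct Γ G :=
    (C g, (g₁ g, t₁ g * t₂ g, h₁ g), t₁ g, w g)
  let T (y : Finset V × (GraphProduct Γ G × (∀ v, G v) × GraphProduct Γ G) ×
      (∀ v, G v) × GraphProduct Γ G) : ℝ≥0∞ :=
    (admissible Γ G y.1 r ∩ tripleProd Γ y.1 ⁻¹' {k}).indicator (fun x =>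
      F y.1 (x.1, y.2.2.1, y.2.2.2) * F' y.1 (y.2.2.2⁻¹, y.2.2.1⁻¹ * x.2.1, x.2.2)) y.2.1
  have he : Function.Injective e := fun g g' hgg => by
    simp only [e, Prod.mk.injEq] at hgg
    rw [(H g).eq_g, (H g').eq_g, hgg.1, hgg.2.1.1, hgg.2.2.1, hgg.2.2.2]
  have hT (g : GraphProduct Γ G) : f g * h (g⁻¹ * k) ≤ T (e g) := by
    by_cases hg : f g = 0
    · simp [hg]
    have hgr := (syllableLength_le_length Lv g).trans (hf g hg)
    have hcard := (H g).add_card_le hgr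
    have hm := familyProd_mul (pairwise_adj_toList (H g).isClique) (t₁ g) (t₂ g)
    have ek : tripleProd Γ (C g) (g₁ g, t₁ g * t₂ g, h₁ g) = k := by
      simp only [tripleProd, hm]
      exact (H g).eq_k.symm
    have eg : tripleProd Γ (C g) (g₁ g, t₁ g, w g) = g := (H g).eq_g.symm
    have eh : tripleProd Γ (C g) ((w g)⁻¹, t₂ g, h₁ g) = g⁻¹ * k := (H g).eq_h.symm
    have mk : (g₁ g, t₁ g * t₂ g, h₁ g) ∈ admissible Γ G (C g) r := by
      refine ⟨(H g).isClique, ht g, ?_, hcard.1⟩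
      rw [ek]
      have := (H g).length_k
      rw [(H g).length_s] at this
      exact this.ge
    have mg : (g₁ g, t₁ g, w g) ∈ admissible Γ G (C g) r := by
      refine ⟨(H g).isClique, ht₁ g, ?_, hcard.1⟩
      rw [eg]
      have := (H g).length_g
      rw [(H g).length_s₁] at this
      exact this.ge
    have mh : ((w g)⁻¹, t₂ g, h₁ g) ∈ admissible Γ G (C g) r := by
      refine ⟨(H g).isClique, ht₂ g, ?_, ?_⟩
      · rw [eh]
        have := (H g).length_h
        rw [(H g).length_s₂] at this
        exact this.ge
      · rw [syllableLength_inv]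
        exact hcard.2
    simp only [T, e, F, F']
    rw [Set.indicator_of_mem (Set.mem_inter mk ek)]
    simp only [inv_mul_cancel_left]
    rw [Set.indicator_of_mem mg, Set.indicator_of_mem mh, eg, eh]
  calc ∑' g, f g * h (g⁻¹ * k) ≤ ∑' g, T (e g) := ENNReal.tsum_le_tsum hT
    _ ≤ ∑' y, T y := ENNReal.tsum_comp_le_tsum_of_injective he T
    _ = ∑ C : Finset V, ∑' x, ∑' z, T (C, x, z) := by
      rw [ENNReal.tsum_prod', tsum_fintype]
      simp_rw [ENNReal.tsum_prod' (α := GraphProduct Γ G × (∀ v, G v) × GraphProduct Γ G)]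
    _ ≤ _ := by
      refine Finset.sum_le_sum fun C _ => ENNReal.tsum_le_tsum fun x => ?_
      by_cases hx : x ∈ admissible Γ G C r ∩ tripleProd Γ C ⁻¹' {k}
      · simp only [T, Set.indicator_of_mem hx]
        rw [ENNReal.tsum_prod']
        -- Cauchy–Schwarz in `w`, for each fixed `t`.
        exact ENNReal.tsum_le_tsum fun t => tsum_mul_le_l2norm _ _
      · simp [T, Set.indicator_of_notMem hx]

/-- One factor for the number of vertex sets comes from Cauchy–Schwarz over `C`, the other from the
final sum over `C`. Of the three prefix counts, one bounds the factorizations of `k` and the others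
come from summing the left and right norms. The product of the `c v` is the bound on the direct
product. -/
theorem convBound_length [Fintype V] {Lv : ∀ v, GroupSeminorm (G v)} {r : ℝ} (hr : 0 ≤ r)
    {c : V → ℝ≥0∞} (hc : ∀ v, ConvBound {x | Lv v x ≤ r} (c v)) :
    ConvBound {g | length Γ Lv g ≤ r} (Fintype.card (Finset V) ^ 2 *
      ENNReal.ofReal ((r + 1) ^ Nat.card V * (r + 1) ^ Nat.card V) ^ 3 * ∏ v, c v) := by
  classical
  intro f h hf
  set N := ENNReal.ofReal ((r + 1) ^ Nat.card V * (r + 1) ^ Nat.card V) with hN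
  set M : ℝ≥0∞ := ((Fintype.card (Finset V) : ℕ) : ℝ≥0∞) with hM
  let Q (C : Finset V) (k : GraphProduct Γ G) := admissible Γ G C r ∩ tripleProd Γ C ⁻¹' {k}
  let D (C : Finset V) (x : GraphProduct Γ G × (∀ v, G v) × GraphProduct Γ G) : ℝ≥0∞ :=
    ∑' t, leftNorm f r C x.1 t * rightNorm h r C x.2.2 (t⁻¹ * x.2.1)
  have h₁ (k : GraphProduct Γ G) : (∑' g, f g * h (g⁻¹ * k)) ^ 2 ≤
      M * ∑ C : Finset V, N * ∑' x, (Q C k).indicator (fun x => D C x ^ 2) x := by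
    refine (pow_le_pow_left' (conv_le_sum_clique Lv h hf k) 2).trans
      ((sq_finset_sum_le _ _).trans ?_)
    rw [Finset.card_univ]
    gcongr with C
    refine (sq_tsum_le_encard (Q C k) _ fun x hx => Set.indicator_of_notMem hx _).trans ?_
    gcongr with x
    · exact encard_admissible_le C hr k
    · by_cases hx : x ∈ Q C k
      · rw [Set.indicator_of_mem hx, Set.indicator_of_mem hx]
      · simp [Set.indicator_of_notMem hx]
  have h₂ (C : Finset V) : ∑' k, ∑' x, (Q C k).indicator (fun x => D C x ^ 2) x ≤
      ∑' x, D C x ^ 2 := by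
    rw [ENNReal.tsum_comm]
    refine ENNReal.tsum_le_tsum fun x => ?_
    -- Each triple factorizes only one `k`.
    rw [tsum_eq_single (tripleProd Γ C x)]
    · exact Set.indicator_le_self _ _ x
    · intro k hk
      exact Set.indicator_of_notMem (fun hx => hk hx.2.symm) _
  have h₃ (C : Finset V) : ∑' x, D C x ^ 2 ≤
      (∏ v, c v) * (N * ∑' g, f g ^ 2) * (N * ∑' g, h g ^ 2) := by
    calc ∑' x, D C x ^ 2 = ∑' a, ∑' b, ∑' s, (∑' t, leftNorm f r C a t *
          rightNorm h r C b (t⁻¹ * s)) ^ 2 := by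
          rw [ENNReal.tsum_prod']
          refine tsum_congr fun a => ?_
          rw [ENNReal.tsum_prod', ENNReal.tsum_comm]
      _ ≤ ∑' a, ∑' b, (∏ v, c v) * (∑' t, leftNorm f r C a t ^ 2) *
          ∑' t, rightNorm h r C b t ^ 2 := by
          refine ENNReal.tsum_le_tsum fun a => ENNReal.tsum_le_tsum fun b => ?_
          exact ConvBound.pi hc _ _ fun t ht v _ => le_of_leftNorm_ne_zero Lv hf ht v
      _ = (∏ v, c v) * (∑' a, ∑' t, leftNorm f r C a t ^ 2) *
          ∑' b, ∑' t, rightNorm h r C b t ^ 2 := by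
          simp_rw [ENNReal.tsum_mul_left, ENNReal.tsum_mul_right, ENNReal.tsum_mul_left]
      _ ≤ _ := by
          gcongr
          · exact tsum_leftNorm_le f hr C
          · exact tsum_rightNorm_le h hr C
  calc ∑' k, (∑' g, f g * h (g⁻¹ * k)) ^ 2
      ≤ ∑' k, M * ∑ C : Finset V, N * ∑' x, (Q C k).indicator (fun x => D C x ^ 2) x :=
        ENNReal.tsum_le_tsum h₁
    _ = M * ∑ C : Finset V, N * ∑' k, ∑' x, (Q C k).indicator (fun x => D C x ^ 2) x := by
        rw [ENNReal.tsum_mul_left, Summable.tsum_finsetSum fun _ _ => ENNReal.summable]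
        simp_rw [ENNReal.tsum_mul_left]
    _ ≤ M * ∑ C : Finset V,
          N * ((∏ v, c v) * (N * ∑' g, f g ^ 2) * (N * ∑' g, h g ^ 2)) := by
        gcongr with C
        exact (h₂ C).trans (h₃ C)
    _ = M ^ 2 * N ^ 3 * (∏ v, c v) * (∑' g, f g ^ 2) * ∑' g, h g ^ 2 := by
        rw [Finset.sum_const, Finset.card_univ, nsmul_eq_mul, ← hM]
        ring

open Polynomial in
theorem hasRD_length [Finite V] {Lv : ∀ v, GroupSeminorm (G v)} (h : ∀ v, HasRD (Lv v)) :
    HasRD (length Γ Lv) := by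
  have := Fintype.ofFinite V
  simp_rw [hasRD_iff_convBound] at h ⊢
  choose P hP hPc using h
  refine ⟨Polynomial.C ((Fintype.card (Finset V) : ℝ) ^ 2) *
    ((X + 1) ^ Nat.card V * (X + 1) ^ Nat.card V) ^ 3 * ∏ v, P v, ?_, fun r hr => ?_⟩
  · have h₁ : NonnegCoeffs ((X + 1 : ℝ[X]) ^ Nat.card V) := (NonnegCoeffs.X.add .one).pow _
    exact ((NonnegCoeffs.C (by positivity)).mul ((h₁.mul h₁).pow 3)).mul (.prod _ hP)
  · refine (convBound_length hr.le fun v => hPc v r hr).mono subset_rfl (le_of_eq ?_)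
    have h₁ : 0 ≤ (r + 1) ^ Nat.card V * (r + 1) ^ Nat.card V := by positivity
    simp only [eval_mul, eval_pow, eval_add, eval_X, eval_one, eval_C, eval_prod]
    generalize (r + 1) ^ Nat.card V * (r + 1) ^ Nat.card V = A at h₁
    rw [ENNReal.ofReal_mul (by positivity), ENNReal.ofReal_mul (by positivity),
      ENNReal.ofReal_pow (by positivity), ENNReal.ofReal_pow h₁, ENNReal.ofReal_natCast,
      ENNReal.ofReal_prod_of_nonneg fun v _ => (hP v).eval_nonneg hr.le]

open Polynomial in
theorem hasRD_of_hasRD_length {Lv : ∀ v, GroupSeminorm (G v)} (h : HasRD (length Γ Lv)) (v : V) :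
    HasRD (Lv v) := by
  rw [hasRD_iff_convBound] at h ⊢
  obtain ⟨P, hP, hPc⟩ := h
  -- The shift by one accounts for the syllable count in `L`.
  refine ⟨P.comp (X + 1), hP.comp (NonnegCoeffs.X.add .one), fun r hr => ?_⟩
  refine ((hPc (r + 1) (by linarith)).comap (of Γ v) (of_injective v)).mono (fun x hx => ?_)
    (le_of_eq (by simp))
  have h₁ := length_of_le (Γ := Γ) Lv v x
  have h₂ : Lv v x ≤ r := hx
  change length Γ Lv (of Γ v x) ≤ r + 1
  linarith

end RapidDecay

end GraphProduct

theorem theorem3p13 {V : Type*} [Finite V] (Γ : SimpleGraph V) (G : V → Type*)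
    [∀ v, Group (G v)] (Lv : ∀ v, GroupSeminorm (G v)) :
    -- the formula for `L` gives a well-defined length function, and `dist` is a metric
    ∃ L : GroupSeminorm (GraphProduct Γ G),
      GraphProduct.IsGraphProductLength Γ Lv L ∧
      (∀ g, L g = 0 → g = 1) ∧
      -- the relative centroid property with respect to the clique subgroups
      HasSubgroupCentroidProperty L
        (fun C : {C : Finset V // Γ.IsClique (C : Set V)} =>
          (GraphProduct.vertexSubgroup Γ C.1 : Subgroup (GraphProduct Γ G))) ∧
      -- maps built from clique factorizations exist, and they are relative centroid maps
      (∃ rc, GraphProduct.IsCliqueCentroidMap (G := G) Γ rc) ∧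
      (∀ rc, GraphProduct.IsCliqueCentroidMap (G := G) Γ rc →
        IsSubgroupCentroidMap L
          (fun C : {C : Finset V // Γ.IsClique (C : Set V)} =>
            (GraphProduct.vertexSubgroup Γ C.1 : Subgroup (GraphProduct Γ G))) rc) ∧
      -- rapid decay
      (HasRD L ↔ ∀ v, HasRD (Lv v)) :=
  ⟨GraphProduct.length Γ Lv, GraphProduct.isGraphProductLength_length Lv,
    fun _ => GraphProduct.eq_one_of_length_eq_zero Lv,
    GraphProduct.hasSubgroupCentroidProperty Lv, GraphProduct.exists_isCliqueCentroidMap Γ G,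
    fun _ hrc => hrc.isSubgroupCentroidMap Lv, GraphProduct.hasRD_of_hasRD_length,
    GraphProduct.hasRD_length⟩
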